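/- Let $n\ge 1$, let $S=\mathbb{C}[w,w^{-1},(w-1)^{-1},(w-2)^{-1}]$ and let $M\in\mathrm{GL}_n(S)$. For a square matrix $A$ over $\mathbb{C}(w)$ let $d_w(A)=\max_{i,j}\deg_w(A_{i,j})$, where $\deg_w(f/g)=\max\{\deg f,\deg g\}$ for coprime polynomials $f,g\in\mathbb{C}[w]$, $g\neq 0$ (and $\deg_w 0=0$). Let $\nu_t$ be the valuation of $\mathbb{C}(w)$ at $t\in\mathbb{P}^1_{\mathbb{C}}$. Consider the following process, applied to $M$. (1) Put $r_t=\min_{i,j}\{\nu_t(M_{i,j}),0\}$ for $t=0,1,2$, and write $M=w^{r_0}(w-1)^{r_1}(w-2)^{r_2}M'$. Choose a Smith normal form $M'=LDR$ over $\mathbb{C}[w]$, with $L,R\in\mathrm{GL}_n(\mathbb{C}[w])$ and $D$ diagonal with entries in $\mathbb{C}[w]$ satisfying $D_{i,i}\mid D_{i+1,i+1}$. Put $U_2=E_1L^{-1}$, where $E_1$ is the diagonal matrix with entries $(w-1)^{-r_1-\nu_1(D_{i,i})}$. (2) Put $N=U_2M$ and $s_0=\min_{i,j}\{\nu_\infty(N_{i,j}),0\}$,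 and write $N=w^{-s_0}(1-2/w)^{r_2}N'$. Choose a Smith normal form $N'=UQV$ over $\mathbb{C}[w^{-1}]$, with $U,V\in\mathrm{GL}_n(\mathbb{C}[w^{-1}])$ and $Q$ diagonal with entries in $\mathbb{C}[w^{-1}]$ satisfying $Q_{i,i}\mid Q_{i+1,i+1}$. Put $U_1=V^{-1}E_2$, where $E_2$ is the diagonal matrix with entries $(1-2/w)^{-r_2-\nu_2(Q_{i,i})}$. Then the choices in this process can be made so that \[U_1\in\mathrm{GL}_n(\mathbb{C}[w^{-1},(w-2)^{-1}]),\qquad U_2\in\mathrm{GL}_n(\mathbb{C}[w,(w-1)^{-1}]),\qquad U_2MU_1\in\mathrm{GL}_n(\mathbb{C}[w,w^{-1}]),\] and \[d_w(U_1)\le(16n^2+1)\,d_w(M)\qquad\text{and}\qquad d_w(U_2)\le(4n-1)\,d_w(M).\] -/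

import Mathlib

open scoped MatrixGroups

noncomputable section

namespace ConicReduction

/-- The rational coordinate `w`, i.e. the variable of the field `ℂ(w)`. -/
abbrev w : RatFunc ℂ := RatFunc.X

/-- `ℂ[w]`, as a subring of `ℂ(w)`. -/
def ringPoly : Subalgebra ℂ (RatFunc ℂ) := Algebra.adjoin ℂ {w}

/-- `ℂ[w⁻¹]`. -/
def ringPolyInv : Subalgebra ℂ (RatFunc ℂ) := Algebra.adjoin ℂ {w⁻¹}

/-- `ℂ[w, w⁻¹]`. -/
def ringLaurent : Subalgebra ℂ (RatFunc ℂ) := Algebra.adjoin ℂ {w, w⁻¹}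

/-- `S = ℂ[w, w⁻¹, (w-1)⁻¹, (w-2)⁻¹]`. -/
def ringS : Subalgebra ℂ (RatFunc ℂ) := Algebra.adjoin ℂ {w, w⁻¹, (w - 1)⁻¹, (w - 2)⁻¹}

/-- `ℂ[w⁻¹, (w-2)⁻¹]`, the ring for the multiplier `U₁`. -/
def ringOne : Subalgebra ℂ (RatFunc ℂ) := Algebra.adjoin ℂ {w⁻¹, (w - 2)⁻¹}

/-- `ℂ[w, (w-1)⁻¹]`, the ring for the multiplier `U₂`. -/
def ringTwo : Subalgebra ℂ (RatFunc ℂ) := Algebra.adjoin ℂ {w, (w - 1)⁻¹}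

/-- `GL_n(A)` for a subring `A` of `ℂ(w)`, as a subgroup of `GL_n(ℂ(w))`. -/
def GLOver (n : ℕ) (A : Subalgebra ℂ (RatFunc ℂ)) : Subgroup (GL (Fin n) (RatFunc ℂ)) :=
  (Matrix.GeneralLinearGroup.map (n := Fin n) (A.val : A →+* RatFunc ℂ)).range

/-- The degree `max (deg f) (deg g)` of a rational function `f / g` in lowest terms. -/
def ratDeg (p : RatFunc ℂ) : ℕ := max p.num.natDegree p.denom.natDegree

/-- `d_w(M)`, the largest degree of an entry of `M`. -/
def dw {n : ℕ} (M : Matrix (Fin n) (Fin n) (RatFunc ℂ)) : ℕ :=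
  Finset.univ.sup fun p : Fin n × Fin n => ratDeg (M p.1 p.2)

/-- The valuation `ν_t` at a finite point `t`, on nonzero rational functions. The value at `0`
is `0` instead of `∞`; below it is only used for nonzero functions, or inside a minimum with `0`,
where a summand `0` and a summand `∞` have the same effect. -/
def nu (t : ℂ) (p : RatFunc ℂ) : ℤ :=
  (p.num.rootMultiplicity t : ℤ) - (p.denom.rootMultiplicity t : ℤ)

/-- The valuation `ν_∞` at `w = ∞` (same convention at `0`). -/
def nuInf (p : RatFunc ℂ) : ℤ := (p.denom.natDegree : ℤ) - (p.num.natDegree : ℤ)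

/-- `min_{i,j} {ν(M_{i,j}), 0}`. -/
def minVal {n : ℕ} (ν : RatFunc ℂ → ℤ) (M : Matrix (Fin n) (Fin n) (RatFunc ℂ)) : ℤ :=
  (insert 0 (Finset.univ.image fun p : Fin n × Fin n => ν (M p.1 p.2))).min'
    (Finset.insert_nonempty _ _)

/-- `N = P · diag(D₁, …, D_n) · Q` is a Smith normal form of `N` over the principal ideal domain
`A`: `P, Q ∈ GL_n(A)`, all `D_i ∈ A`, and `D_i` divides `D_j` in `A` for `i ≤ j`. -/
structure IsSmithForm {n : ℕ} (A : Subalgebra ℂ (RatFunc ℂ))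
    (N : Matrix (Fin n) (Fin n) (RatFunc ℂ))
    (P : GL (Fin n) (RatFunc ℂ)) (D : Fin n → RatFunc ℂ) (Q : GL (Fin n) (RatFunc ℂ)) :
    Prop where
  left_mem : P ∈ GLOver n A
  right_mem : Q ∈ GLOver n A
  diag_mem : ∀ i, D i ∈ A
  dvd : ∀ i j, i ≤ j → ∃ c ∈ A, D j = c * D i
  eq : N = P.val * Matrix.diagonal D * Q.val

/-- `M' = w^{-r₀} (w-1)^{-r₁} (w-2)^{-r₂} M` with `r_t = min_{i,j} {ν_t(M_{i,j}), 0}`: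
the matrix over `ℂ[w]` obtained from `M` by extracting denominators. -/
def clearFinite {n : ℕ} (M : Matrix (Fin n) (Fin n) (RatFunc ℂ)) :
    Matrix (Fin n) (Fin n) (RatFunc ℂ) :=
  (w ^ (-minVal (nu 0) M) * (w - 1) ^ (-minVal (nu 1) M) * (w - 2) ^ (-minVal (nu 2) M)) • M

/-- `N' = w^{s₀} (1-2/w)^{-r₂} N` with `s₀ = min_{i,j} {ν_∞(N_{i,j}), 0}`. -/
def clearInf {n : ℕ} (r₂ : ℤ) (N : Matrix (Fin n) (Fin n) (RatFunc ℂ)) :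
    Matrix (Fin n) (Fin n) (RatFunc ℂ) :=
  (w ^ (minVal nuInf N) * (1 - 2 / w) ^ (-r₂)) • N

/-- `(U₁, U₂)` is a possible outcome of the reduction process applied to `M`:
* choose a Smith normal form `M' = L D R` over `ℂ[w]` and put `U₂ = E₁ L⁻¹`, where `E₁` is
  diagonal with entries `(w-1)^{-r₁-k_i}`, `k_i = ν₁(D_i)`;
* for `N = U₂ M`, choose a Smith normal form `N' = U Q V` over `ℂ[w⁻¹]` and put `U₁ = V⁻¹ E₂`,
  where `E₂` is diagonal with entries `(1-2/w)^{-r₂-l_i}`, `l_i = ν₂(Q_i)`. -/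
def IsReduction {n : ℕ} (M U₁ U₂ : GL (Fin n) (RatFunc ℂ)) : Prop :=
  ∃ (L R : GL (Fin n) (RatFunc ℂ)) (D : Fin n → RatFunc ℂ)
    (U V : GL (Fin n) (RatFunc ℂ)) (Q : Fin n → RatFunc ℂ),
    IsSmithForm ringPoly (clearFinite M.val) L D R ∧
    U₂.val = Matrix.diagonal (fun i => (w - 1) ^ (-minVal (nu 1) M.val - nu 1 (D i))) *
      (L⁻¹).val ∧
    IsSmithForm ringPolyInv (clearInf (minVal (nu 2) M.val) (U₂ * M).val) U Q V ∧
    U₁.val = (V⁻¹).val *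
      Matrix.diagonal (fun i => (1 - 2 / w) ^ (-minVal (nu 2) M.val - nu 2 (Q i)))

end ConicReduction

end

/-! Diagonalising by `D` and `Q` makes the factors at `1` and `2` visible, so the diagonal matrices
`E₁` and `E₂` can cancel them. Since `det M⁻¹ ∈ S`, the determinant of `M'` divides some `w^a
(w-1)^b (w-2)^c`, and so does each `D_i`. Thus `U₂` removes every factor `w-1`, leaving `U₂ M =
w^(-ρ₀) (w-2)^(-ρ₂) p` with `p` polynomial and `det p = u w^a (w-2)^c`. In the coordinate `w⁻¹` the
only primes left are `w⁻¹` and `1 - 2/w`; removing the second leaves `U` times a diagonal matrix of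
monomials in `w`.

The difficulty is the degrees, since an arbitrary Smith form has no bound on its multipliers.
`exists_smith_natDegree_le` chooses `T A = diag(D) R` with all entries of degree at most `deg det
A`. By Cramer's rule `T = (T A) adj(A) / det A`, so `deg T ≤ (n-1) δ` when `A` has degree at most
`δ` (`natDegree_multiplier_le`). To get this choice, divide by the content, use a generic constant
combination of columns as a primitive first column, reduce it to a unit vector, recurse on the
complementary block, and reduce the first row modulo the rows of the diagonalised block.

With `d = d_w(M)`, the first step has `δ ≤ 4d` and gives `deg p ≤ 4nd`. The second runs over
`ℂ[w⁻¹]` with `δ ≤ 4nd`, on the transpose because its multiplier acts on the right. -/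

open Polynomial Matrix

/-! ### Smith forms over `k[X]` with controlled degrees -/

section UnimodularReduction

variable {k : Type*} [Field k]

/-- The block matrix `[[a, x], [0, B]]`. -/
def blockTri {R : Type*} [CommRing R] {n : ℕ} (a : R) (x : Fin n → R)
    (B : Matrix (Fin n) (Fin n) R) : Matrix (Fin (n + 1)) (Fin (n + 1)) R :=
  Matrix.of (Fin.cons (Fin.cons a x) fun i => Fin.cons 0 (B i))

section blockTri

variable {R : Type*} [CommRing R] {n : ℕ} (a : R) (x : Fin n → R) (B : Matrix (Fin n) (Fin n) R)

@[simp] lemma blockTri_zero_zero : blockTri a x B 0 0 = a := rfl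
@[simp] lemma blockTri_zero_succ (j : Fin n) : blockTri a x B 0 j.succ = x j := rfl
@[simp] lemma blockTri_succ_zero (i : Fin n) : blockTri a x B i.succ 0 = 0 := rfl
@[simp] lemma blockTri_succ_succ (i j : Fin n) : blockTri a x B i.succ j.succ = B i j := rfl

lemma blockTri_mul (a' : R) (x' : Fin n → R) (B' : Matrix (Fin n) (Fin n) R) :
    blockTri a x B * blockTri a' x' B' = blockTri (a * a') (a • x' + x ᵥ* B') (B * B') := by
  ext i j
  refine Fin.cases ?_ (fun i => ?_) i <;> refine Fin.cases ?_ (fun j => ?_) j <;>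
    simp [Matrix.mul_apply, Fin.sum_univ_succ, Matrix.vecMul, dotProduct]

lemma det_blockTri : (blockTri a x B).det = a * B.det := by
  have h : (blockTri a x B).submatrix Fin.succ Fin.succ = B := by ext i j; simp
  rw [Matrix.det_succ_column_zero, Fin.sum_univ_succ]
  simp [h, Fin.succAbove_zero]

lemma eq_blockTri (A : Matrix (Fin (n + 1)) (Fin (n + 1)) R) (h : ∀ i : Fin n, A i.succ 0 = 0) :
    A = blockTri (A 0 0) (fun j => A 0 j.succ) (A.submatrix Fin.succ Fin.succ) := by
  ext i j
  refine Fin.cases ?_ (fun i => ?_) i <;> refine Fin.cases ?_ (fun j => ?_) j <;> simp [h]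

end blockTri

lemma det_one_updateCol {R : Type*} [CommRing R] {n : ℕ} (v : Fin n → R) (i : Fin n) :
    ((1 : Matrix (Fin n) (Fin n) R).updateCol i v).det = v i := by
  rw [← Matrix.cramer_apply, Matrix.cramer_one]; rfl

lemma mul_updateCol_one_apply {R : Type*} [CommRing R] {n : ℕ}
    (A : Matrix (Fin n) (Fin n) R) (v : Fin n → R) (j i : Fin n) :
    (A * (1 : Matrix (Fin n) (Fin n) R).updateCol j v) i j = (A *ᵥ v) i := by
  simp [Matrix.mul_apply, Matrix.mulVec, dotProduct]

/-- Euclid's algorithm for a column vector. -/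
lemma exists_mulVec_eq_single {n : ℕ} (u : Fin (n + 1) → k[X]) :
    ∃ (T : Matrix (Fin (n + 1)) (Fin (n + 1)) k[X]) (g : k[X]),
      IsUnit T.det ∧ T *ᵥ u = Pi.single 0 g := by
  classical
  by_cases hu : u = 0
  · exact ⟨1, 0, by simp, by simp [hu]⟩
  have hex : ∃ d : ℕ, ∃ T : Matrix (Fin (n + 1)) (Fin (n + 1)) k[X],
      IsUnit T.det ∧ (T *ᵥ u) 0 ≠ 0 ∧ ((T *ᵥ u) 0).natDegree = d := by
    obtain ⟨i, hi⟩ := Function.ne_iff.mp hu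
    refine ⟨_, (Equiv.swap 0 i).permMatrix k[X], ?_, ?_, rfl⟩
    · rw [Matrix.det_permutation, Equiv.Perm.sign_swap']
      split_ifs <;> simp
    · simpa [Equiv.Perm.permMatrix, PEquiv.toMatrix_toPEquiv_mulVec] using hi
  obtain ⟨T, hT, h0, hd⟩ := Nat.find_spec hex
  have hmin : ∀ T' : Matrix (Fin (n + 1)) (Fin (n + 1)) k[X], IsUnit T'.det →
      (T' *ᵥ u) 0 ≠ 0 → ((T *ᵥ u) 0).natDegree ≤ ((T' *ᵥ u) 0).natDegree := by
    intro T' h1 h2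
    rw [hd]
    exact Nat.find_min' hex ⟨T', h1, h2, rfl⟩
  set x := T *ᵥ u with hx
  have hdvd : ∀ j, x 0 ∣ x j := by
    intro j
    by_cases hj : j = 0
    · rw [hj]
    by_contra hnd
    have hr : x j % x 0 ≠ 0 := fun h => hnd (EuclideanDomain.mod_eq_zero.mp h)
    have hlt : (x j % x 0).degree < (x 0).degree := EuclideanDomain.mod_lt _ h0
    have hlt' : (x j % x 0).natDegree < (x 0).natDegree := natDegree_lt_natDegree hr hlt
    let E := (Equiv.swap 0 j).permMatrix k[X] * (Matrix.transvection j 0 (-(x j / x 0)) * T)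
    have key : (E *ᵥ u) 0 = x j % x 0 := by
      rw [← Matrix.mulVec_mulVec, ← Matrix.mulVec_mulVec, ← hx]
      simp only [Equiv.Perm.permMatrix, PEquiv.toMatrix_toPEquiv_mulVec, Function.comp,
        Equiv.swap_apply_left, Matrix.transvection, Matrix.add_mulVec, Matrix.one_mulVec,
        Pi.add_apply]
      have : (Matrix.single j 0 (-(x j / x 0)) *ᵥ x) j = -(x j / x 0) * x 0 := by
        simp [Matrix.mulVec, dotProduct, Matrix.single_apply]
      rw [this, EuclideanDomain.mod_eq_sub_mul_div]
      ring
    have hE : IsUnit E.det := by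
      rw [Matrix.det_mul, Matrix.det_mul, Matrix.det_transvection_of_ne _ _ hj _, one_mul,
        Matrix.det_permutation, Equiv.Perm.sign_swap']
      refine IsUnit.mul ?_ hT
      split_ifs <;> simp
    have := hmin E hE (by rw [key]; exact hr)
    rw [key] at this
    omega
  choose q hq using hdvd
  -- An entry 0 of minimal nonzero degree divides all others, so this matrix clears them by
  -- subtracting `q j` times entry 0 from entry `j`.
  refine ⟨(1 : Matrix _ _ k[X]).updateCol 0 (fun j => if j = 0 then 1 else -q j) * T, x 0, ?_, ?_⟩
  · rw [Matrix.det_mul, det_one_updateCol]; simpa using hT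
  · rw [← Matrix.mulVec_mulVec, ← hx]
    ext1 j
    refine Fin.cases ?_ (fun j => ?_) j
    · simp [Matrix.mulVec, dotProduct, Fin.sum_univ_succ, Matrix.updateCol_apply, Matrix.one_apply,
        (Fin.succ_ne_zero _).symm]
    · have := hq j.succ
      simp [Matrix.mulVec, dotProduct, Fin.sum_univ_succ, Matrix.updateCol_apply, Matrix.one_apply,
        Fin.succ_ne_zero]
      rw [this]; ring

lemma isUnit_of_forall_eval_ne_zero [IsAlgClosed k] {g : k[X]} (h : ∀ t, g.eval t ≠ 0) :
    IsUnit g := by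
  by_contra hg
  by_cases h0 : g.degree = 0
  · exact hg (isUnit_iff_degree_eq_zero.mpr h0)
  · obtain ⟨t, ht⟩ := IsAlgClosed.exists_root g h0
    exact h t ht

lemma exists_mulVec_eq_single_one [IsAlgClosed k] {n : ℕ} (u : Fin (n + 1) → k[X])
    (hu : ∀ t, ∃ i, (u i).eval t ≠ 0) :
    ∃ T : Matrix (Fin (n + 1)) (Fin (n + 1)) k[X], IsUnit T.det ∧ T *ᵥ u = Pi.single 0 1 := by
  obtain ⟨T, g, hT, h⟩ := exists_mulVec_eq_single u
  have hg : IsUnit g := by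
    refine isUnit_of_forall_eval_ne_zero fun t ht => ?_
    obtain ⟨i, hi⟩ := hu t
    apply hi
    have h2 : u = T⁻¹ *ᵥ Pi.single 0 g := by
      rw [← h, Matrix.mulVec_mulVec, Matrix.nonsing_inv_mul _ hT, Matrix.one_mulVec]
    rw [h2]
    simp [Matrix.mulVec, dotProduct, Pi.single_apply, ht]
  obtain ⟨g, rfl⟩ := hg
  refine ⟨((g⁻¹ : k[X]ˣ) : k[X]) • T, ?_, ?_⟩
  · rw [Matrix.det_smul]
    exact ((Units.isUnit _).pow _).mul hT
  · rw [Matrix.smul_mulVec, h]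
    ext1 j
    by_cases hj : j = 0
    · subst hj; simp
    · simp [hj]

/-- A generic constant combination of the columns of a primitive matrix is primitive. -/
lemma exists_generic_column [Infinite k] {n : ℕ} (A : Matrix (Fin (n + 1)) (Fin (n + 1)) k[X])
    (hdet : A.det ≠ 0) (hA : ∀ t, ∃ i j, (A i j).eval t ≠ 0) :
    ∃ v : Fin (n + 1) → k, v 0 ≠ 0 ∧ ∀ t, ∃ i, ((A *ᵥ fun j => C (v j)) i).eval t ≠ 0 := by
  classical
  -- Finitely many proper subspaces to avoid: `none` is the hyperplane `v 0 = 0`, and `some t` is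
  -- the kernel of `A(t)` at a root `t` of the determinant. At any other `t` the matrix `A(t)` is
  -- invertible.
  let s : Finset (Option k) := insert none (A.det.roots.toFinset.image some)
  let W : Option k → Submodule k (Fin (n + 1) → k) := fun o =>
    o.elim (LinearMap.ker (LinearMap.proj 0)) fun t => LinearMap.ker (A.map (eval t)).mulVecLin
  have hW : ∀ o ∈ s, W o ≠ ⊤ := by
    intro o _ htop
    rcases o with _ | t
    · have : (Pi.single 0 1 : Fin (n + 1) → k) ∈ W none := by rw [htop]; trivial
      simp [W] at this
    · obtain ⟨i, j, hij⟩ := hA t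
      have : (Pi.single j 1 : Fin (n + 1) → k) ∈ W (some t) := by rw [htop]; trivial
      simp only [W, Option.elim, LinearMap.mem_ker, Matrix.mulVecLin_apply] at this
      have := congrFun this i
      simp at this
      exact hij this
  have hne := Subspace.biUnion_ne_univ_of_top_notMem (s := s.image W) (by
    intro h
    obtain ⟨o, ho, h⟩ := Finset.mem_image.mp h
    exact hW o ho h)
  obtain ⟨v, hv⟩ := (Set.ne_univ_iff_exists_notMem _).mp hne
  simp only [Set.mem_iUnion, not_exists, Finset.mem_image] at hv
  have hv' : ∀ o ∈ s, v ∉ W o := fun o ho h => hv (W o) ⟨o, ho, rfl⟩ h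
  have h0 : v 0 ≠ 0 := by
    have := hv' none (by simp [s])
    simpa [W] using this
  refine ⟨v, h0, fun t => ?_⟩
  have hmap : ∀ i, ((A *ᵥ fun j => C (v j)) i).eval t = ((A.map (eval t)) *ᵥ v) i := by
    intro i
    simp [Matrix.mulVec, dotProduct, eval_finsetSum]
  simp only [hmap]
  by_contra! hcon
  have hz : (A.map (eval t)) *ᵥ v = 0 := funext hcon
  by_cases ht : A.det.eval t = 0
  · exact hv' (some t) (by simp [s, hdet, ht]) (by simpa [W] using hz)
  · have hd : (A.map (eval t)).det ≠ 0 := by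
      have := (RingHom.map_det (evalRingHom t) A)
      simp only [coe_evalRingHom, RingHom.mapMatrix_apply] at this
      rwa [← this]
    exact h0 (congrFun (Matrix.eq_zero_of_mulVec_eq_zero hd hz) 0)

lemma exists_content {n : ℕ} (A : Matrix (Fin n) (Fin n) k[X]) (hA : A ≠ 0) :
    ∃ (g : k[X]) (B : Matrix (Fin n) (Fin n) k[X]), A = g • B ∧
      ∀ t, ∃ i j, (B i j).eval t ≠ 0 := by
  let I : Ideal k[X] := Ideal.span (Set.range fun p : Fin n × Fin n => A p.1 p.2)
  have hg : I = Ideal.span {Submodule.IsPrincipal.generator I} :=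
    (Ideal.span_singleton_generator I).symm
  set g := Submodule.IsPrincipal.generator I
  have hdvd : ∀ i j, g ∣ A i j := by
    intro i j
    rw [← Ideal.mem_span_singleton, ← hg]
    exact Ideal.subset_span ⟨(i, j), rfl⟩
  have hg0 : g ≠ 0 := by
    intro h
    apply hA
    refine Matrix.ext fun i j => ?_
    have := hdvd i j
    rw [h, zero_dvd_iff] at this
    exact this
  choose B hB using hdvd
  refine ⟨g, Matrix.of B, by ext i j : 2; simp [hB], fun t => ?_⟩
  by_contra! hcon
  -- If the quotient matrix vanished at `t`, then `(X - t) g` would divide all entries, hence also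
  -- the generator `g`, making `X - t` a unit.
  have hle : I ≤ Ideal.span {(X - C t) * g} := by
    refine Ideal.span_le.mpr ?_
    rintro _ ⟨⟨i, j⟩, rfl⟩
    rw [SetLike.mem_coe, Ideal.mem_span_singleton]
    obtain ⟨c, hc⟩ := dvd_iff_isRoot.mpr (hcon i j)
    simp only [Matrix.of_apply] at hc
    exact ⟨c, by simp only [hB, hc]; ring⟩
  have hmem : g ∈ I := by rw [hg]; exact Ideal.mem_span_singleton_self g
  obtain ⟨c, hc⟩ := Ideal.mem_span_singleton.mp (hle hmem)
  have h1 : (X - C t) * c = 1 := by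
    apply mul_left_cancel₀ hg0
    linear_combination -hc
  exact not_isUnit_X_sub_C t (IsUnit.of_mul_eq_one _ h1)

/-- Reduction of a row vector modulo the rows of a nonsingular matrix. -/
lemma exists_natDegree_sub_vecMul_le {n : ℕ} (G : Matrix (Fin n) (Fin n) k[X]) (hG : G.det ≠ 0)
    {Δ : ℕ} (hΔ : ∀ i j, (G i j).natDegree ≤ Δ) (x : Fin n → k[X]) :
    ∃ z : Fin n → k[X], ∀ j, ((x - z ᵥ* G) j).natDegree ≤ Δ := by
  -- Dividing `x adj(G)` by `det G` leaves a remainder `r` with `det G • (x - z G) = r G`. As `deg r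
  -- < deg det G`, comparing degrees bounds `x - z G`.
  let p := x ᵥ* G.adjugate
  let z : Fin n → k[X] := fun j => p j / G.det
  let r : Fin n → k[X] := fun j => p j % G.det
  have hp : p = G.det • z + r := by
    ext1 j
    simpa [z, r] using (EuclideanDomain.div_add_mod (p j) G.det).symm
  have hy : G.det • (x - z ᵥ* G) = r ᵥ* G := by
    have h1 : p ᵥ* G = G.det • x := by
      simp [p, Matrix.vecMul_vecMul, Matrix.adjugate_mul, Matrix.vecMul_smul]
    rw [hp, Matrix.add_vecMul, Matrix.smul_vecMul] at h1
    rw [smul_sub, ← h1]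
    abel
  refine ⟨z, fun j => ?_⟩
  by_cases h0 : (x - z ᵥ* G) j = 0
  · simp [h0]
  have h1 : (G.det * (x - z ᵥ* G) j).natDegree ≤ G.det.natDegree + Δ := by
    have : G.det * (x - z ᵥ* G) j = ∑ i, r i * G i j := congrFun hy j
    rw [this]
    refine natDegree_sum_le_of_forall_le _ _ fun i _ => ?_
    refine (natDegree_mul_le (p := r i) (q := G i j)).trans (add_le_add ?_ (hΔ i j))
    exact natDegree_le_natDegree (show (r i).degree < _ from EuclideanDomain.mod_lt _ hG).le
  rw [natDegree_mul hG h0] at h1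
  omega

/-- A nonsingular polynomial matrix `A` has a Smith form `T A = diag(D) R` with `T`, `R` unimodular
and `deg (diag(D) R) ≤ deg (det A)`. -/
theorem exists_smith_natDegree_le [IsAlgClosed k] : ∀ (n : ℕ) (A : Matrix (Fin n) (Fin n) k[X]),
    A.det ≠ 0 → ∃ (T : Matrix (Fin n) (Fin n) k[X]) (D : Fin n → k[X])
      (R : Matrix (Fin n) (Fin n) k[X]), IsUnit T.det ∧ IsUnit R.det ∧
      (∀ i j, i ≤ j → D i ∣ D j) ∧ T * A = Matrix.diagonal D * R ∧
      ∀ i j, (D i * R i j).natDegree ≤ A.det.natDegree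
  | 0, A, _ => ⟨1, 1, 1, by simp, by simp, fun i => i.elim0, by ext i; exact i.elim0,
      fun i => i.elim0⟩
  | n + 1, A, hA => by
    obtain ⟨g, A₁, rfl, hprim⟩ := exists_content A (by
      rintro rfl
      simp [Matrix.det_zero] at hA)
    rw [Matrix.det_smul, Fintype.card_fin] at hA
    have hA₁ : A₁.det ≠ 0 := right_ne_zero_of_mul hA
    have hg : g ≠ 0 := by
      rintro rfl
      simp at hA
    obtain ⟨v, hv0, hv⟩ := exists_generic_column A₁ hA₁ hprim
    obtain ⟨T₀, hT₀, hT₀v⟩ := exists_mulVec_eq_single_one _ hv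
    -- The condition `v 0 ≠ 0` makes this matrix invertible. It and its inverse are constant, so
    -- this column change costs no degree.
    set C₀ : Matrix (Fin (n + 1)) (Fin (n + 1)) k := (1 : Matrix _ _ k).updateCol 0 v with hC₀
    have hC₀det : IsUnit C₀.det := by rw [hC₀, det_one_updateCol]; exact hv0.isUnit
    set P : Matrix (Fin (n + 1)) (Fin (n + 1)) k[X] := C₀.map C with hP
    have hPdet : IsUnit P.det := by
      have := RingHom.map_det (C : k →+* k[X]) C₀
      rw [RingHom.mapMatrix_apply] at this
      rw [hP, ← this]
      exact hC₀det.map C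
    have hP' : P = (1 : Matrix _ _ k[X]).updateCol 0 (fun j => C (v j)) := by
      ext i j : 2
      simp only [hP, hC₀, Matrix.map_apply, Matrix.updateCol_apply, Matrix.one_apply]
      split_ifs <;> simp
    have hcol : ∀ i, (T₀ * A₁ * P) i 0 = (Pi.single 0 1 : Fin (n + 1) → k[X]) i := by
      intro i
      rw [hP', mul_updateCol_one_apply, ← Matrix.mulVec_mulVec, hT₀v]
    have hblk := eq_blockTri (T₀ * A₁ * P) (fun i => by rw [hcol]; simp)
    rw [hcol 0, Pi.single_eq_same] at hblk
    set x := fun j : Fin n => (T₀ * A₁ * P) 0 j.succ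
    set B := (T₀ * A₁ * P).submatrix (Fin.succ : Fin n → _) Fin.succ
    have hdet : T₀.det * A₁.det * P.det = B.det := by
      rw [← Matrix.det_mul, ← Matrix.det_mul, hblk, det_blockTri, one_mul]
    have hB : B.det ≠ 0 := by
      rw [← hdet]
      exact mul_ne_zero (mul_ne_zero hT₀.ne_zero hA₁) hPdet.ne_zero
    have hdeg : B.det.natDegree = A₁.det.natDegree := by
      rw [← hdet, natDegree_mul (mul_ne_zero hT₀.ne_zero hA₁) hPdet.ne_zero,
        natDegree_mul hT₀.ne_zero hA₁, natDegree_eq_zero_of_isUnit hT₀,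
        natDegree_eq_zero_of_isUnit hPdet, zero_add, add_zero]
    obtain ⟨T', D', R', hT', hR', hD', hTB, hdeg'⟩ := exists_smith_natDegree_le n B hB
    have hG : (T' * B).det ≠ 0 := by
      rw [Matrix.det_mul]
      exact mul_ne_zero hT'.ne_zero hB
    -- Subtracting multiples of the lower rows is a unimodular row operation, and it bounds the
    -- otherwise uncontrolled first row.
    obtain ⟨z, hz⟩ := exists_natDegree_sub_vecMul_le (T' * B) hG (Δ := B.det.natDegree)
      (fun i j => by rw [hTB, Matrix.diagonal_mul]; exact hdeg' i j) x
    set y := x - z ᵥ* (T' * B) with hy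
    set T₁ := blockTri 1 (-z) 1 * blockTri 1 0 T' * T₀ with hT₁
    have hT₁det : IsUnit T₁.det := by
      rw [hT₁, Matrix.det_mul, Matrix.det_mul, det_blockTri, det_blockTri]
      simpa using hT'.mul hT₀
    have hred : T₁ * A₁ * P = blockTri 1 y (T' * B) := by
      rw [hT₁, Matrix.mul_assoc, Matrix.mul_assoc, ← Matrix.mul_assoc T₀, hblk, Matrix.mul_assoc,
        blockTri_mul, blockTri_mul]
      simp [hy, Matrix.neg_vecMul, sub_eq_add_neg]
    have hdiag : blockTri 1 y (T' * B) =
        Matrix.diagonal (Fin.cons 1 D' : Fin (n + 1) → k[X]) * blockTri 1 y R' := by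
      ext i j : 2
      rw [Matrix.diagonal_mul]
      refine Fin.cases ?_ (fun i => ?_) i <;> refine Fin.cases ?_ (fun j => ?_) j <;>
        simp [hTB, Matrix.diagonal_mul]
    have hsmall : ∀ i j, (blockTri 1 y (T' * B) i j).natDegree ≤ A₁.det.natDegree := by
      intro i j
      refine Fin.cases ?_ (fun i => ?_) i <;> refine Fin.cases ?_ (fun j => ?_) j
      · simp
      · rw [blockTri_zero_succ, ← hdeg]; exact hz j
      · simp
      · rw [blockTri_succ_succ, ← hdeg, hTB, Matrix.diagonal_mul]; exact hdeg' i j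
    have hPinv : P⁻¹ = (C₀⁻¹).map C := by
      refine Matrix.inv_eq_left_inv ?_
      rw [hP, ← Matrix.map_mul, Matrix.nonsing_inv_mul _ hC₀det]
      exact Matrix.map_one _ C_0 C_1
    have hmain : T₁ * A₁ =
        Matrix.diagonal (Fin.cons 1 D' : Fin (n + 1) → k[X]) * (blockTri 1 y R' * P⁻¹) := by
      rw [← Matrix.mul_assoc, ← hdiag, ← hred, Matrix.mul_assoc (T₁ * A₁),
        Matrix.mul_nonsing_inv _ hPdet, Matrix.mul_one]
    refine ⟨T₁, fun i => g * (Fin.cons 1 D' : Fin (n + 1) → k[X]) i, blockTri 1 y R' * P⁻¹,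
      hT₁det, ?_, ?_, ?_, ?_⟩
    · rw [Matrix.det_mul, det_blockTri, one_mul]
      exact hR'.mul (Matrix.isUnit_nonsing_inv_det _ hPdet)
    · intro i j hij
      refine mul_dvd_mul_left g ?_
      revert hij
      refine Fin.cases ?_ (fun i => ?_) i <;> refine Fin.cases ?_ (fun j => ?_) j
      · simp
      · simp
      · intro h; simp at h
      · intro h; simpa using hD' i j (Fin.succ_le_succ_iff.mp h)
    · rw [Matrix.mul_smul, hmain]
      ext i j : 2
      simp [Matrix.diagonal_mul, mul_assoc]
    · intro i j
      have h1 : (T₁ * A₁) i j =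
          (Fin.cons 1 D' : Fin (n + 1) → k[X]) i * (blockTri 1 y R' * P⁻¹) i j := by
        rw [hmain, Matrix.diagonal_mul]
      have h2 : T₁ * A₁ = blockTri 1 y (T' * B) * P⁻¹ := by
        rw [← hred, Matrix.mul_assoc (T₁ * A₁), Matrix.mul_nonsing_inv _ hPdet, Matrix.mul_one]
      -- The content multiplies each entry once but the determinant `n + 1` times, so restoring it
      -- preserves the bound.
      rw [mul_assoc, ← h1, h2, Matrix.det_smul, Fintype.card_fin,
        natDegree_mul (pow_ne_zero _ hg) hA₁, natDegree_pow]
      refine natDegree_mul_le.trans (add_le_add (Nat.le_mul_of_pos_left _ n.succ_pos) ?_)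
      rw [Matrix.mul_apply]
      refine natDegree_sum_le_of_forall_le _ _ fun l _ => ?_
      refine natDegree_mul_le.trans ?_
      rw [hPinv, Matrix.map_apply, natDegree_C, add_zero]
      exact hsmall i l

/-! ### Degrees of determinants, adjugates and multipliers -/

lemma natDegree_det_le {n : ℕ} (A : Matrix (Fin n) (Fin n) k[X]) {δ : ℕ}
    (h : ∀ i j, (A i j).natDegree ≤ δ) : A.det.natDegree ≤ n * δ := by
  rw [Matrix.det_apply]
  refine natDegree_sum_le_of_forall_le _ _ fun σ _ => ?_
  refine (natDegree_smul_le _ _).trans ((natDegree_prod_le _ _).trans ?_)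
  exact (Finset.sum_le_card_nsmul _ _ δ fun i _ => h _ _).trans (by simp)

lemma natDegree_adjugate_le {n : ℕ} (A : Matrix (Fin n) (Fin n) k[X]) {δ : ℕ}
    (h : ∀ i j, (A i j).natDegree ≤ δ) (i j : Fin n) :
    (A.adjugate i j).natDegree ≤ (n - 1) * δ := by
  cases n with
  | zero => exact i.elim0
  | succ n =>
    rw [Matrix.adjugate_fin_succ_eq_det_submatrix]
    refine natDegree_mul_le.trans ?_
    have h1 : ((-1 : k[X]) ^ (j + i : ℕ)).natDegree = 0 :=
      natDegree_eq_zero_of_isUnit (isUnit_one.neg.pow _)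
    rw [h1, zero_add]
    exact natDegree_det_le _ fun _ _ => h _ _

/-- Cramer's rule: `det A • T = (T A) adj(A)`. The bound on `T A` cancels `deg det A`, leaving only
the degree of the adjugate. -/
lemma natDegree_multiplier_le {n : ℕ} {A T : Matrix (Fin n) (Fin n) k[X]} (hA : A.det ≠ 0)
    {δ : ℕ} (hδ : ∀ i j, (A i j).natDegree ≤ δ)
    (hTA : ∀ i j, ((T * A) i j).natDegree ≤ A.det.natDegree) (i j : Fin n) :
    (T i j).natDegree ≤ (n - 1) * δ := by
  by_cases h0 : T i j = 0
  · simp [h0]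
  have h1 : A.det * T i j = (T * A * A.adjugate) i j := by
    rw [Matrix.mul_assoc, Matrix.mul_adjugate]
    simp
  have h2 : (A.det * T i j).natDegree ≤ A.det.natDegree + (n - 1) * δ := by
    rw [h1, Matrix.mul_apply]
    refine natDegree_sum_le_of_forall_le _ _ fun l _ => ?_
    exact natDegree_mul_le.trans (add_le_add (hTA i l) (natDegree_adjugate_le A hδ l j))
  rw [natDegree_mul hA h0] at h2
  omega

lemma dvd_det_of_smith {R : Type*} [CommRing R] {n : ℕ} {A T S : Matrix (Fin n) (Fin n) R}
    {D : Fin n → R} (hT : IsUnit T.det) (h : T * A = Matrix.diagonal D * S) (i : Fin n) :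
    D i ∣ A.det := by
  have h1 := congrArg Matrix.det h
  rw [Matrix.det_mul, Matrix.det_mul, Matrix.det_diagonal] at h1
  rw [← hT.dvd_mul_left, h1]
  exact (Finset.dvd_prod_of_mem D (Finset.mem_univ i)).mul_right _

end UnimodularReduction

noncomputable section

namespace ConicReduction

/-! ### Matrix groups over subrings of `ℂ(w)` -/

section membership

variable {n : ℕ} {A B : Subalgebra ℂ (RatFunc ℂ)}

lemma mem_GLOver_iff {g : GL (Fin n) (RatFunc ℂ)} :
    g ∈ GLOver n A ↔ (∀ i j, g.val i j ∈ A) ∧ ∀ i j, (g⁻¹).val i j ∈ A := by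
  constructor
  · rintro ⟨h, rfl⟩
    refine ⟨fun i j => (h.val i j).2, fun i j => ?_⟩
    rw [← map_inv]
    exact ((h⁻¹).val i j).2
  · rintro ⟨h1, h2⟩
    have hinj : Function.Injective (A.val : A →+* RatFunc ℂ).mapMatrix :=
      Matrix.map_injective Subtype.val_injective (m := Fin n) (n := Fin n)
    let P : Matrix (Fin n) (Fin n) A := Matrix.of fun i j => ⟨g.val i j, h1 i j⟩
    let Q : Matrix (Fin n) (Fin n) A := Matrix.of fun i j => ⟨(g⁻¹).val i j, h2 i j⟩
    have hP : (A.val : A →+* RatFunc ℂ).mapMatrix P = g.val := rfl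
    have hQ : (A.val : A →+* RatFunc ℂ).mapMatrix Q = (g⁻¹).val := rfl
    refine ⟨⟨P, Q, hinj ?_, hinj ?_⟩, Units.ext rfl⟩
    · rw [map_mul, hP, hQ, map_one]; exact g.mul_inv
    · rw [map_mul, hP, hQ, map_one]; exact g.inv_mul

lemma GLOver_mono (h : A ≤ B) : GLOver n A ≤ GLOver n B := fun _ hg =>
  mem_GLOver_iff.mpr ⟨fun i j => h ((mem_GLOver_iff.mp hg).1 i j),
    fun i j => h ((mem_GLOver_iff.mp hg).2 i j)⟩

/-- The invertible diagonal matrix with nonzero entries `e`. -/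
def diagGL (e : Fin n → RatFunc ℂ) (he : ∀ i, e i ≠ 0) : GL (Fin n) (RatFunc ℂ) where
  val := Matrix.diagonal e
  inv := Matrix.diagonal fun i => (e i)⁻¹
  val_inv := by simp [Matrix.diagonal_mul_diagonal, he]
  inv_val := by simp [Matrix.diagonal_mul_diagonal, he]

lemma diagGL_mem {e : Fin n → RatFunc ℂ} {he : ∀ i, e i ≠ 0} (h1 : ∀ i, e i ∈ A)
    (h2 : ∀ i, (e i)⁻¹ ∈ A) : diagGL e he ∈ GLOver n A := by
  refine mem_GLOver_iff.mpr ⟨fun i j => ?_, fun i j => ?_⟩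
  · change Matrix.diagonal e i j ∈ A
    rw [Matrix.diagonal_apply]
    split_ifs
    · exact h1 i
    · exact A.zero_mem
  · change Matrix.diagonal (fun i => (e i)⁻¹) i j ∈ A
    rw [Matrix.diagonal_apply]
    split_ifs
    · exact h2 i
    · exact A.zero_mem

/-- The image of a unimodular polynomial matrix under a ring homomorphism to `ℂ(w)`. -/
def polyGL (f : ℂ[X] →+* RatFunc ℂ) (T : Matrix (Fin n) (Fin n) ℂ[X]) (hT : IsUnit T.det) :
    GL (Fin n) (RatFunc ℂ) :=
  Matrix.GeneralLinearGroup.map f (T.nonsingInvUnit hT)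

lemma val_polyGL (f : ℂ[X] →+* RatFunc ℂ) (T : Matrix (Fin n) (Fin n) ℂ[X]) (hT : IsUnit T.det) :
    (polyGL f T hT).val = T.map f := rfl

lemma polyGL_mem {f : ℂ[X] →+* RatFunc ℂ} (hf : ∀ p, f p ∈ A) (T : Matrix (Fin n) (Fin n) ℂ[X])
    (hT : IsUnit T.det) : polyGL f T hT ∈ GLOver n A := by
  refine mem_GLOver_iff.mpr ⟨fun i j => hf _, fun i j => ?_⟩
  rw [polyGL, ← map_inv]
  exact hf _

lemma isSmithForm_of_left {f : ℂ[X] →+* RatFunc ℂ} (hf : ∀ p, f p ∈ A)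
    {N T R : Matrix (Fin n) (Fin n) ℂ[X]} {D : Fin n → ℂ[X]} (hT : IsUnit T.det)
    (hR : IsUnit R.det) (hD : ∀ i j, i ≤ j → D i ∣ D j) (h : T * N = Matrix.diagonal D * R) :
    IsSmithForm A (N.map f) (polyGL f T hT)⁻¹ (fun i => f (D i)) (polyGL f R hR) where
  left_mem := inv_mem (polyGL_mem hf T hT)
  right_mem := polyGL_mem hf R hR
  diag_mem i := hf _
  dvd i j hij := by
    obtain ⟨c, hc⟩ := hD i j hij
    exact ⟨f c, hf c, by rw [hc, map_mul, mul_comm]⟩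
  eq := by
    have h1 := congrArg f.mapMatrix h
    rw [map_mul, map_mul] at h1
    simp only [RingHom.mapMatrix_apply, Matrix.diagonal_map (map_zero f)] at h1
    have h2 : N.map f = (polyGL f T hT)⁻¹.val * ((polyGL f T hT).val * N.map f) := by
      rw [← Matrix.mul_assoc, Units.inv_mul, Matrix.one_mul]
    rw [h2, val_polyGL f T hT, val_polyGL f R hR, h1, Matrix.mul_assoc]

lemma isSmithForm_of_right {f : ℂ[X] →+* RatFunc ℂ} (hf : ∀ p, f p ∈ A)
    {N T R : Matrix (Fin n) (Fin n) ℂ[X]} {D : Fin n → ℂ[X]} (hT : IsUnit T.det)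
    (hR : IsUnit R.det) (hD : ∀ i j, i ≤ j → D i ∣ D j) (h : N * T = R * Matrix.diagonal D) :
    IsSmithForm A (N.map f) (polyGL f R hR) (fun i => f (D i)) (polyGL f T hT)⁻¹ where
  left_mem := polyGL_mem hf R hR
  right_mem := inv_mem (polyGL_mem hf T hT)
  diag_mem i := hf _
  dvd i j hij := by
    obtain ⟨c, hc⟩ := hD i j hij
    exact ⟨f c, hf c, by rw [hc, map_mul, mul_comm]⟩
  eq := by
    have h1 := congrArg f.mapMatrix h
    rw [map_mul, map_mul] at h1
    simp only [RingHom.mapMatrix_apply, Matrix.diagonal_map (map_zero f)] at h1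
    have h2 : N.map f = N.map f * (polyGL f T hT).val * (polyGL f T hT)⁻¹.val := by
      rw [Matrix.mul_assoc, Units.mul_inv, Matrix.mul_one]
    rw [h2, val_polyGL f T hT, val_polyGL f R hR, h1]

end membership

/-! ### Degrees and valuations of rational functions -/

section valuations

lemma ratDeg_le {x : RatFunc ℂ} {p q : ℂ[X]} {m : ℕ} (hq : q ≠ 0)
    (h : x = algebraMap ℂ[X] (RatFunc ℂ) p / algebraMap ℂ[X] (RatFunc ℂ) q)
    (hp : p.natDegree ≤ m) (hqm : q.natDegree ≤ m) : ratDeg x ≤ m := by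
  by_cases hp0 : p = 0
  · subst hp0
    simp [h, ratDeg]
  · refine max_le ?_ ?_
    · rw [h]
      exact (natDegree_le_of_dvd (RatFunc.num_div_dvd p hq) hp0).trans hp
    · rw [h]
      exact (natDegree_le_of_dvd (RatFunc.denom_div_dvd p q) hq).trans hqm

lemma nu_div (t : ℂ) {p q : ℂ[X]} (hp : p ≠ 0) (hq : q ≠ 0) :
    nu t (algebraMap ℂ[X] (RatFunc ℂ) p / algebraMap ℂ[X] (RatFunc ℂ) q) =
      (p.rootMultiplicity t : ℤ) - q.rootMultiplicity t := by
  set x := algebraMap ℂ[X] (RatFunc ℂ) p / algebraMap ℂ[X] (RatFunc ℂ) q with hx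
  have hq' : algebraMap ℂ[X] (RatFunc ℂ) q ≠ 0 := by simpa using hq
  have hp' : algebraMap ℂ[X] (RatFunc ℂ) p ≠ 0 := by simpa using hp
  have hd' : algebraMap ℂ[X] (RatFunc ℂ) x.denom ≠ 0 := by simpa using x.denom_ne_zero
  have hn : x.num ≠ 0 := by
    rw [Ne, RatFunc.num_eq_zero_iff]
    exact div_ne_zero hp' hq'
  have h1 : x.num * q = p * x.denom := by
    apply RatFunc.algebraMap_injective ℂ
    rw [map_mul, map_mul, ← div_eq_div_iff hd' hq', RatFunc.num_div_denom]
  have h2 := congrArg (rootMultiplicity t) h1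
  rw [rootMultiplicity_mul (mul_ne_zero hn hq),
    rootMultiplicity_mul (mul_ne_zero hp x.denom_ne_zero)] at h2
  rw [nu]
  omega

lemma nu_algebraMap (t : ℂ) {p : ℂ[X]} (hp : p ≠ 0) :
    nu t (algebraMap ℂ[X] (RatFunc ℂ) p) = p.rootMultiplicity t := by
  have := nu_div t hp one_ne_zero
  rw [map_one, div_one, ← C_1, rootMultiplicity_C] at this
  simpa using this

lemma nuInf_eq (x : RatFunc ℂ) : nuInf x = -x.intDegree := by
  rw [nuInf, RatFunc.intDegree]; ring

variable {n : ℕ} (ν : RatFunc ℂ → ℤ) (M : Matrix (Fin n) (Fin n) (RatFunc ℂ))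

lemma minVal_nonpos : minVal ν M ≤ 0 := Finset.min'_le _ _ (Finset.mem_insert_self _ _)

lemma minVal_le (i j : Fin n) : minVal ν M ≤ ν (M i j) :=
  Finset.min'_le _ _ (Finset.mem_insert_of_mem (Finset.mem_image_of_mem
    (fun p : Fin n × Fin n => ν (M p.1 p.2)) (Finset.mem_univ (i, j))))

lemma minVal_eq : minVal ν M = 0 ∨ ∃ i j, minVal ν M = ν (M i j) := by
  have h := Finset.min'_mem (insert 0 (Finset.univ.image fun p : Fin n × Fin n => ν (M p.1 p.2)))
    (Finset.insert_nonempty _ _)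
  rcases Finset.mem_insert.mp h with h | h
  · exact Or.inl h
  · obtain ⟨p, -, hp⟩ := Finset.mem_image.mp h
    exact Or.inr ⟨p.1, p.2, hp.symm⟩

lemma ratDeg_le_dw (i j : Fin n) : ratDeg (M i j) ≤ dw M :=
  Finset.le_sup (f := fun p : Fin n × Fin n => ratDeg (M p.1 p.2)) (Finset.mem_univ (i, j))

lemma rootMultiplicity_le_natDegree (p : ℂ[X]) (t : ℂ) :
    p.rootMultiplicity t ≤ p.natDegree := by
  rw [← count_roots]
  exact (Multiset.count_le_card _ _).trans (card_roots' p)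

lemma neg_minVal_nu_le (t : ℂ) : -minVal (nu t) M ≤ dw M := by
  rcases minVal_eq (nu t) M with h | ⟨i, j, h⟩
  · rw [h]; positivity
  · have h1 := rootMultiplicity_le_natDegree (M i j).denom t
    have h2 := ratDeg_le_dw M i j
    have h3 : (M i j).denom.natDegree ≤ ratDeg (M i j) := le_max_right _ _
    rw [h, nu]
    omega

end valuations

/-! ### Divisors of products of the distinguished primes -/

section monomials

/-- The polynomial `w^a (w-1)^b (w-2)^c`. -/
def triple (a b c : ℕ) : ℂ[X] := X ^ a * (X - 1) ^ b * (X - 2) ^ c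

lemma X_sub_one_eq : (X - 1 : ℂ[X]) = X - C 1 := by simp
lemma X_sub_two_eq : (X - 2 : ℂ[X]) = X - C 2 := by rw [map_ofNat]

lemma triple_ne_zero (a b c : ℕ) : triple a b c ≠ 0 := by
  rw [triple, X_sub_one_eq, X_sub_two_eq]
  exact mul_ne_zero (mul_ne_zero (pow_ne_zero _ X_ne_zero) (pow_ne_zero _ (X_sub_C_ne_zero _)))
    (pow_ne_zero _ (X_sub_C_ne_zero _))

lemma triple_mul (a b c a' b' c' : ℕ) :
    triple a b c * triple a' b' c' = triple (a + a') (b + b') (c + c') := by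
  simp only [triple, pow_add]; ring

lemma triple_pow (a b c m : ℕ) : triple a b c ^ m = triple (a * m) (b * m) (c * m) := by
  simp only [triple, mul_pow, pow_mul]

lemma natDegree_triple (a b c : ℕ) : (triple a b c).natDegree = a + b + c := by
  rw [triple, X_sub_one_eq, X_sub_two_eq, natDegree_mul, natDegree_mul, natDegree_pow,
    natDegree_pow, natDegree_pow, natDegree_X, natDegree_X_sub_C, natDegree_X_sub_C]
  · ring
  all_goals simp [X_sub_C_ne_zero, X_ne_zero, -map_one]

lemma algebraMap_triple (a b c : ℕ) :
    algebraMap ℂ[X] (RatFunc ℂ) (triple a b c) = w ^ a * (w - 1) ^ b * (w - 2) ^ c := by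
  simp only [triple, map_mul, map_pow, map_sub, RatFunc.algebraMap_X, map_one, map_ofNat]

lemma rootMultiplicity_triple (u : ℂ) (hu : u ≠ 0) (a b c : ℕ) (t : ℂ) :
    (C u * triple a b c).rootMultiplicity t =
      (if t = 0 then a else 0) + (if t = 1 then b else 0) + (if t = 2 then c else 0) := by
  have hX : (X : ℂ[X]) = X - C 0 := by simp
  have h1 := mul_ne_zero (C_ne_zero.mpr hu) (triple_ne_zero a b c)
  have h2 := triple_ne_zero a b c
  rw [rootMultiplicity_mul h1, rootMultiplicity_C, zero_add]
  rw [triple] at h2 ⊢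
  rw [rootMultiplicity_mul h2, rootMultiplicity_mul (left_ne_zero_of_mul h2), X_sub_one_eq,
    X_sub_two_eq]
  nth_rw 1 [hX]
  simp only [← count_roots, roots_pow, Multiset.count_nsmul, roots_X_sub_C,
    Multiset.count_singleton, mul_ite, mul_one, mul_zero]

lemma exists_eq_of_dvd_triple {D : ℂ[X]} {a b c : ℕ} (h : D ∣ triple a b c) :
    ∃ (u : ℂ) (a' b' c' : ℕ), u ≠ 0 ∧ D = C u * triple a' b' c' := by
  obtain ⟨D₁, D₂, h₁, h₂, rfl⟩ := exists_dvd_and_dvd_of_dvd_mul h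
  obtain ⟨D₃, D₄, h₃, h₄, rfl⟩ := exists_dvd_and_dvd_of_dvd_mul h₁
  rw [X_sub_two_eq] at h₂
  rw [X_sub_one_eq] at h₄
  obtain ⟨c', -, hc⟩ := (dvd_prime_pow (prime_X_sub_C _) _).mp h₂
  obtain ⟨b', -, hb⟩ := (dvd_prime_pow (prime_X_sub_C _) _).mp h₄
  obtain ⟨a', -, ha⟩ := (dvd_prime_pow prime_X _).mp h₃
  have hass : Associated (D₃ * D₄ * D₂) (triple a' b' c') := by
    rw [triple, X_sub_one_eq, X_sub_two_eq]
    exact (ha.mul_mul hb).mul_mul hc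
  obtain ⟨v, hv⟩ := hass.symm
  obtain ⟨u, hu, hu'⟩ := isUnit_iff.mp v.isUnit
  exact ⟨u, a', b', c', hu.ne_zero, by rw [← hv, ← hu', mul_comm]⟩

lemma prime_one_sub_two_mul_X : Prime (1 - 2 * X : ℂ[X]) := by
  have h : Associated (X - C (1 / 2) : ℂ[X]) (1 - 2 * X) := by
    refine ⟨Units.mk (C (-2)) (C (-1 / 2)) ?_ ?_, ?_⟩
    · rw [← C_mul, ← C_1]; norm_num
    · rw [← C_mul, ← C_1]; norm_num
    · change (X - C (1 / 2)) * C (-2 : ℂ) = 1 - 2 * X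
      rw [sub_mul, ← C_mul, show (1 / 2 * (-2) : ℂ) = -1 by norm_num, C_neg, C_neg, C_1, map_ofNat]
      ring
  exact h.prime (prime_X_sub_C _)

lemma exists_eq_of_dvd_pow_mul_pow {D : ℂ[X]} {a b : ℕ} (h : D ∣ X ^ a * (1 - 2 * X) ^ b) :
    ∃ (u : ℂ) (a' b' : ℕ), u ≠ 0 ∧ D = C u * (X ^ a' * (1 - 2 * X) ^ b') := by
  obtain ⟨D₁, D₂, h₁, h₂, rfl⟩ := exists_dvd_and_dvd_of_dvd_mul h
  obtain ⟨b', -, hb⟩ := (dvd_prime_pow prime_one_sub_two_mul_X _).mp h₂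
  obtain ⟨a', -, ha⟩ := (dvd_prime_pow prime_X _).mp h₁
  obtain ⟨v, hv⟩ := (ha.mul_mul hb).symm
  obtain ⟨u, hu, hu'⟩ := isUnit_iff.mp v.isUnit
  exact ⟨u, a', b', hu.ne_zero, by rw [← hv, ← hu', mul_comm]⟩

end monomials

/-! ### Passing between `ℂ[w]` and `ℂ[w⁻¹]` -/

section rings

lemma algebraMap_mem_ringPoly (p : ℂ[X]) : algebraMap ℂ[X] (RatFunc ℂ) p ∈ ringPoly := by
  rw [ringPoly, Algebra.adjoin_singleton_eq_range_aeval]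
  refine ⟨p, ?_⟩
  change aeval w p = _
  rw [w, ← RatFunc.algebraMap_X, aeval_algebraMap_apply, aeval_X_left_apply]

/-- The substitution `p ↦ p(w⁻¹)`. -/
def evalInv : ℂ[X] →+* RatFunc ℂ := (aeval (w⁻¹ : RatFunc ℂ) : ℂ[X] →ₐ[ℂ] RatFunc ℂ)

lemma evalInv_mem_ringPolyInv (p : ℂ[X]) : evalInv p ∈ ringPolyInv := by
  rw [ringPolyInv, Algebra.adjoin_singleton_eq_range_aeval]
  exact ⟨p, rfl⟩

lemma w_ne_zero : w ≠ 0 := RatFunc.X_ne_zero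

lemma w_sub_one_ne_zero : (w - 1 : RatFunc ℂ) ≠ 0 := by
  have h : algebraMap ℂ[X] (RatFunc ℂ) (X - C 1) ≠ 0 :=
    RatFunc.algebraMap_ne_zero (X_sub_C_ne_zero (1 : ℂ))
  simpa only [map_sub, RatFunc.algebraMap_X, map_one, map_ofNat] using h

lemma w_sub_two_ne_zero : (w - 2 : RatFunc ℂ) ≠ 0 := by
  have h : algebraMap ℂ[X] (RatFunc ℂ) (X - C 2) ≠ 0 :=
    RatFunc.algebraMap_ne_zero (X_sub_C_ne_zero (2 : ℂ))
  simpa only [map_sub, RatFunc.algebraMap_X, map_one, map_ofNat] using h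

lemma one_sub_two_div_w : (1 - 2 / w : RatFunc ℂ) = (w - 2) / w := by
  field_simp [w_ne_zero]

lemma one_sub_two_div_w_ne_zero : (1 - 2 / w : RatFunc ℂ) ≠ 0 := by
  rw [one_sub_two_div_w]
  exact div_ne_zero w_sub_two_ne_zero w_ne_zero

@[simp] lemma evalInv_C (c : ℂ) : evalInv (C c) = algebraMap ℂ (RatFunc ℂ) c := aeval_C _ _
@[simp] lemma evalInv_X : evalInv X = w⁻¹ := aeval_X _

/-- Reversing coefficients changes the coordinate to `w⁻¹` at the cost of a factor `w^m`. -/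
lemma algebraMap_eq_evalInv_reflect {p : ℂ[X]} {m : ℕ} (hp : p.natDegree ≤ m) :
    algebraMap ℂ[X] (RatFunc ℂ) p = evalInv (reflect m p) * w ^ m := by
  let _ : Invertible (w : RatFunc ℂ) := invertibleOfNonzero w_ne_zero
  have h := eval₂_reflect_mul_pow (algebraMap ℂ (RatFunc ℂ)) w m p hp
  have h1 : algebraMap ℂ[X] (RatFunc ℂ) p = eval₂ (algebraMap ℂ (RatFunc ℂ)) w p := by
    change _ = aeval w p
    rw [w, ← RatFunc.algebraMap_X, aeval_algebraMap_apply, aeval_X_left_apply]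
  rw [h1, ← h, invOf_eq_inv]
  rfl

lemma natDegree_reflect_le' {p : ℂ[X]} {m : ℕ} (hp : p.natDegree ≤ m) :
    (reflect m p).natDegree ≤ m :=
  natDegree_reflect_le.trans (max_le le_rfl hp)

lemma evalInv_eq {p : ℂ[X]} {m : ℕ} (hp : p.natDegree ≤ m) :
    evalInv p * w ^ m = algebraMap ℂ[X] (RatFunc ℂ) (reflect m p) := by
  rw [algebraMap_eq_evalInv_reflect (natDegree_reflect_le' hp), reflect_reflect]

lemma evalInv_injective : Function.Injective evalInv := by
  rw [injective_iff_map_eq_zero]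
  intro p hp
  have h := evalInv_eq (le_refl p.natDegree)
  rw [hp, zero_mul, eq_comm] at h
  simpa using h

end rings

end ConicReduction

end

noncomputable section

namespace ConicReduction

/-! ### Clearing denominators at `0`, `1` and `2` -/

section finitePart

lemma exists_mul_triple_eq {x : RatFunc ℂ} (hx : x ∈ ringS) :
    ∃ (N : ℕ) (p : ℂ[X]), x * algebraMap ℂ[X] (RatFunc ℂ) (triple N N N) =
      algebraMap ℂ[X] (RatFunc ℂ) p := by
  have h0 := w_ne_zero
  have h1 := w_sub_one_ne_zero
  have h2 := w_sub_two_ne_zero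
  refine Algebra.adjoin_induction ?_ ?_ ?_ ?_ hx
  · intro y hy
    simp only [Set.mem_insert_iff, Set.mem_singleton_iff] at hy
    rcases hy with rfl | rfl | rfl | rfl
    · exact ⟨0, X, by simp [triple]⟩
    · refine ⟨1, triple 0 1 1, ?_⟩
      rw [algebraMap_triple, algebraMap_triple]
      field_simp
    · refine ⟨1, triple 1 0 1, ?_⟩
      rw [algebraMap_triple, algebraMap_triple]
      field_simp
    · refine ⟨1, triple 1 1 0, ?_⟩
      rw [algebraMap_triple, algebraMap_triple]
      field_simp
  · intro r
    refine ⟨0, C r, ?_⟩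
    rw [RatFunc.algebraMap_C, ← RatFunc.algebraMap_eq_C]
    simp [triple]
  · rintro y z - - ⟨N, p, hp⟩ ⟨N', q, hq⟩
    refine ⟨N + N', p * triple N' N' N' + q * triple N N N, ?_⟩
    rw [← triple_mul, map_mul, map_add, map_mul, map_mul, ← hp, ← hq]
    ring
  · rintro y z - - ⟨N, p, hp⟩ ⟨N', q, hq⟩
    refine ⟨N + N', p * q, ?_⟩
    rw [← triple_mul, map_mul, map_mul, ← hp, ← hq]
    ring

/-- In lowest terms numerator and denominator share no root, so at a pole the valuation is exactly
minus the multiplicity in the denominator. -/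
lemma rootMultiplicity_denom_le {x : RatFunc ℂ} {t : ℂ} {ρ : ℕ} (h : -(ρ : ℤ) ≤ nu t x) :
    x.denom.rootMultiplicity t ≤ ρ := by
  by_cases h0 : x.denom.rootMultiplicity t = 0
  · omega
  have hroot : x.denom.IsRoot t := by
    by_contra hc
    exact h0 (rootMultiplicity_eq_zero hc)
  have hnum : ¬ x.num.IsRoot t := by
    intro hc
    obtain ⟨a, b, hab⟩ := x.isCoprime_num_denom
    have := congrArg (eval t) hab
    rw [eval_add, eval_mul, eval_mul, hroot.eq_zero, hc.eq_zero] at this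
    simp at this
  rw [nu, rootMultiplicity_eq_zero hnum] at h
  omega

lemma denom_dvd_triple {x : RatFunc ℂ} (hx : x ∈ ringS) {ρ₀ ρ₁ ρ₂ : ℕ}
    (h₀ : -(ρ₀ : ℤ) ≤ nu 0 x) (h₁ : -(ρ₁ : ℤ) ≤ nu 1 x) (h₂ : -(ρ₂ : ℤ) ≤ nu 2 x) :
    x.denom ∣ triple ρ₀ ρ₁ ρ₂ := by
  obtain ⟨N, p, hp⟩ := exists_mul_triple_eq hx
  have hne := RatFunc.algebraMap_ne_zero (triple_ne_zero N N N)
  have hdvd : x.denom ∣ triple N N N :=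
    (RatFunc.denom_dvd (triple_ne_zero N N N)).mpr ⟨p, by rw [eq_div_iff hne, hp]⟩
  obtain ⟨u, a, b, c, hu, hD⟩ := exists_eq_of_dvd_triple hdvd
  have e₀ := rootMultiplicity_denom_le h₀
  have e₁ := rootMultiplicity_denom_le h₁
  have e₂ := rootMultiplicity_denom_le h₂
  rw [hD, rootMultiplicity_triple u hu] at e₀ e₁ e₂
  norm_num at e₀ e₁ e₂
  rw [hD]
  have hCu : IsUnit (C u) := hu.isUnit.map C
  rw [hCu.mul_left_dvd, triple, triple]
  exact mul_dvd_mul (mul_dvd_mul (pow_dvd_pow _ e₀) (pow_dvd_pow _ e₁)) (pow_dvd_pow _ e₂)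

variable {n : ℕ}

lemma val_mem_and_det_inv_mem {A : Subalgebra ℂ (RatFunc ℂ)} {M : GL (Fin n) (RatFunc ℂ)}
    (hM : M ∈ GLOver n A) : (∀ i j, M.val i j ∈ A) ∧ (M⁻¹).val.det ∈ A := by
  refine ⟨(mem_GLOver_iff.mp hM).1, ?_⟩
  obtain ⟨h, rfl⟩ := hM
  have h1 := RingHom.map_det (A.val : A →+* RatFunc ℂ) (h⁻¹).val
  rw [← map_inv]
  exact h1 ▸ ((h⁻¹).val.det).2

lemma exists_clearFinite_eq_map {M : GL (Fin n) (RatFunc ℂ)} (hM : M ∈ GLOver n ringS)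
    {ρ₀ ρ₁ ρ₂ : ℕ} (h₀ : -minVal (nu 0) M.val = ρ₀) (h₁ : -minVal (nu 1) M.val = ρ₁)
    (h₂ : -minVal (nu 2) M.val = ρ₂) :
    ∃ A : Matrix (Fin n) (Fin n) ℂ[X],
      clearFinite M.val = A.map (algebraMap ℂ[X] (RatFunc ℂ)) ∧
      (algebraMap ℂ[X] (RatFunc ℂ) (triple ρ₀ ρ₁ ρ₂)) • M.val =
        A.map (algebraMap ℂ[X] (RatFunc ℂ)) ∧
      (∀ i j, (A i j).natDegree ≤ dw M.val + ρ₀ + ρ₁ + ρ₂) ∧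
      ∃ a b c, A.det ∣ triple a b c := by
  obtain ⟨hmem, hdet⟩ := val_mem_and_det_inv_mem hM
  have hdvd : ∀ i j, (M.val i j).denom ∣ triple ρ₀ ρ₁ ρ₂ := by
    intro i j
    have e₀ := minVal_le (nu 0) M.val i j
    have e₁ := minVal_le (nu 1) M.val i j
    have e₂ := minVal_le (nu 2) M.val i j
    exact denom_dvd_triple (hmem i j) (by omega) (by omega) (by omega)
  choose c hc using hdvd
  let A : Matrix (Fin n) (Fin n) ℂ[X] := Matrix.of fun i j => (M.val i j).num * c i j
  have hA : (algebraMap ℂ[X] (RatFunc ℂ) (triple ρ₀ ρ₁ ρ₂)) • M.val =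
      A.map (algebraMap ℂ[X] (RatFunc ℂ)) := by
    refine Matrix.ext fun i j => ?_
    have hden := RatFunc.algebraMap_ne_zero (M.val i j).denom_ne_zero
    have hx := RatFunc.num_div_denom (M.val i j)
    rw [div_eq_iff hden] at hx
    rw [Matrix.smul_apply, smul_eq_mul, hc i j, Matrix.map_apply,
      show A i j = (M.val i j).num * c i j from rfl, map_mul, map_mul, hx]
    ring
  refine ⟨A, ?_, hA, ?_, ?_⟩
  · rw [← hA, clearFinite, h₀, h₁, h₂, algebraMap_triple]
    simp only [zpow_natCast]
  · intro i j
    have h1 := congrArg natDegree (hc i j)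
    have hc0 : c i j ≠ 0 := fun h => triple_ne_zero ρ₀ ρ₁ ρ₂ (by rw [hc i j, h, mul_zero])
    rw [natDegree_triple, natDegree_mul (M.val i j).denom_ne_zero hc0] at h1
    have h2 : (M.val i j).num.natDegree ≤ ratDeg (M.val i j) := le_max_left _ _
    have h3 := ratDeg_le_dw M.val i j
    have h4 : (A i j).natDegree ≤ (M.val i j).num.natDegree + (c i j).natDegree :=
      natDegree_mul_le
    omega
  -- Since `det M⁻¹` has finite poles only at `0`, `1`, `2`, clearing them exhibits a cofactor of
  -- `det A` in a product of these primes.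
  · obtain ⟨N, q, hq⟩ := exists_mul_triple_eq hdet
    have h1 : (M⁻¹).val.det * M.val.det = 1 := by
      rw [← Matrix.det_mul, Units.inv_mul, Matrix.det_one]
    have h2 := congrArg Matrix.det hA
    rw [Matrix.det_smul, Fintype.card_fin] at h2
    have h3 := RingHom.map_det (algebraMap ℂ[X] (RatFunc ℂ)) A
    rw [RingHom.mapMatrix_apply] at h3
    rw [← h3] at h2
    have h4 : A.det * q = triple ρ₀ ρ₁ ρ₂ ^ n * triple N N N := by
      apply RatFunc.algebraMap_injective ℂ
      rw [map_mul, map_mul, map_pow, ← hq, ← h2]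
      linear_combination (algebraMap ℂ[X] (RatFunc ℂ) (triple ρ₀ ρ₁ ρ₂) ^ n *
        algebraMap ℂ[X] (RatFunc ℂ) (triple N N N)) * h1
    rw [triple_pow, triple_mul] at h4
    exact ⟨_, _, _, Dvd.intro q h4⟩

/-- For negative `z` the degree is a maximum, not a sum: the power of `w - 1` only enters the
denominator. -/
lemma ratDeg_zpow_mul_le {p : ℂ[X]} {m B : ℕ} (hp : p.natDegree ≤ m) (hm : m ≤ B) (z : ℤ)
    (h1 : m + z ≤ B) (h2 : -z ≤ B) :
    ratDeg ((w - 1) ^ z * algebraMap ℂ[X] (RatFunc ℂ) p) ≤ B := by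
  obtain ⟨l, rfl | rfl⟩ := z.eq_nat_or_neg
  · refine ratDeg_le (p := triple 0 l 0 * p) one_ne_zero ?_ ?_ (by simp)
    · rw [map_mul, algebraMap_triple, zpow_natCast]
      simp
    · refine natDegree_mul_le.trans ?_
      rw [natDegree_triple]
      omega
  · refine ratDeg_le (p := p) (triple_ne_zero 0 l 0) ?_ (hp.trans hm) ?_
    · rw [algebraMap_triple, _root_.zpow_neg, zpow_natCast]
      simp [div_eq_inv_mul]
    · rw [natDegree_triple]
      omega

end finitePart

/-! ### Degrees and determinants in the coordinate `w⁻¹` -/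

section infinitePart

variable {n : ℕ}

lemma evalInv_one_sub_two_mul_X : evalInv (1 - 2 * X) = 1 - 2 / w := by
  rw [map_sub, map_mul, evalInv_X, map_one, map_ofNat, div_eq_mul_inv]

lemma ratDeg_evalInv_mul_zpow_le {p : ℂ[X]} {m B : ℕ} (hp : p.natDegree ≤ m) (z : ℤ)
    (hz : z.natAbs ≤ B) : ratDeg (evalInv p * (1 - 2 / w) ^ z) ≤ m + B := by
  have h0 := w_ne_zero
  have h2 := w_sub_two_ne_zero
  have hr := natDegree_reflect_le' hp
  have he := evalInv_eq hp
  rw [← eq_div_iff (pow_ne_zero _ h0)] at he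
  obtain ⟨l, rfl | rfl⟩ := z.eq_nat_or_neg
  · refine ratDeg_le (p := reflect m p * triple 0 0 l) (triple_ne_zero (m + l) 0 0) ?_ ?_ ?_
    · rw [he, map_mul, algebraMap_triple, algebraMap_triple, zpow_natCast, one_sub_two_div_w,
        div_pow, pow_add]
      field_simp
    · refine natDegree_mul_le.trans ?_
      rw [natDegree_triple]
      omega
    · rw [natDegree_triple]
      omega
  · refine ratDeg_le (p := reflect m p * triple l 0 0) (triple_ne_zero m 0 l) ?_ ?_ ?_
    · rw [he, map_mul, algebraMap_triple, algebraMap_triple, _root_.zpow_neg, zpow_natCast,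
        one_sub_two_div_w, div_pow]
      field_simp
    · refine natDegree_mul_le.trans ?_
      rw [natDegree_triple]
      omega
    · rw [natDegree_triple]
      omega

lemma nu_two_evalInv {u : ℂ} (hu : u ≠ 0) (a b : ℕ) :
    nu 2 (evalInv (C u * (X ^ a * (1 - 2 * X) ^ b))) = b := by
  have h0 := w_ne_zero
  have h : evalInv (C u * (X ^ a * (1 - 2 * X) ^ b)) =
      algebraMap ℂ[X] (RatFunc ℂ) (C u * triple 0 0 b) /
        algebraMap ℂ[X] (RatFunc ℂ) (C 1 * triple (a + b) 0 0) := by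
    rw [map_mul, map_mul, map_pow, map_pow, evalInv_one_sub_two_mul_X, evalInv_X, evalInv_C,
      map_mul, map_mul, algebraMap_triple, algebraMap_triple, RatFunc.algebraMap_C, map_one, map_one,
      ← RatFunc.algebraMap_eq_C, one_sub_two_div_w, div_pow, pow_add, inv_pow]
    field_simp
  rw [h, nu_div _ (mul_ne_zero (C_ne_zero.mpr hu) (triple_ne_zero _ _ _))
    (mul_ne_zero (C_ne_zero.mpr one_ne_zero) (triple_ne_zero _ _ _)),
    rootMultiplicity_triple u hu, rootMultiplicity_triple 1 one_ne_zero]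
  norm_num

lemma map_reflect_eq {p : Matrix (Fin n) (Fin n) ℂ[X]} {ε : ℕ}
    (hp : ∀ i j, (p i j).natDegree ≤ ε) :
    (p.map (reflect ε)).map evalInv =
      (w ^ ε)⁻¹ • p.map (algebraMap ℂ[X] (RatFunc ℂ)) := by
  refine Matrix.ext fun i j => ?_
  rw [Matrix.smul_apply, smul_eq_mul, Matrix.map_apply, Matrix.map_apply, Matrix.map_apply,
    algebraMap_eq_evalInv_reflect (hp i j)]
  field_simp [w_ne_zero]

lemma det_map_reflect_dvd {p : Matrix (Fin n) (Fin n) ℂ[X]} {ε : ℕ}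
    (hp : ∀ i j, (p i j).natDegree ≤ ε) {u : ℂ} (hu : u ≠ 0) {a c : ℕ}
    (hdet : p.det = C u * triple a 0 c) :
    (p.map (reflect ε)).det ∣ X ^ (ε * n) * (1 - 2 * X) ^ c := by
  have h0 := w_ne_zero
  -- The determinant becomes `u w^(a+c-εn) (1-2/w)^c`; this cofactor cancels `u` and `w^(a+c)`.
  refine Dvd.intro (C u⁻¹ * X ^ (a + c)) (evalInv_injective ?_)
  have h1 := RingHom.map_det evalInv (p.map (reflect ε))
  rw [RingHom.mapMatrix_apply, map_reflect_eq hp, Matrix.det_smul, Fintype.card_fin] at h1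
  have h2 := RingHom.map_det (algebraMap ℂ[X] (RatFunc ℂ)) p
  rw [RingHom.mapMatrix_apply] at h2
  rw [← h2, hdet, map_mul, algebraMap_triple, RatFunc.algebraMap_C, ← RatFunc.algebraMap_eq_C] at h1
  have hu' : algebraMap ℂ (RatFunc ℂ) u ≠ 0 := by simpa using hu
  rw [map_mul, h1, map_mul, map_mul, map_pow, map_pow, map_pow, evalInv_one_sub_two_mul_X,
    evalInv_X, evalInv_C, one_sub_two_div_w, div_pow, map_inv₀, pow_add, pow_mul]
  simp only [inv_pow]
  field_simp

lemma prod_C_mul_triple (u : Fin n → ℂ) (a c : Fin n → ℕ) :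
    ∏ i, C (u i) * triple (a i) 0 (c i) = C (∏ i, u i) * triple (∑ i, a i) 0 (∑ i, c i) := by
  simp only [triple, Finset.prod_mul_distrib, Finset.prod_pow_eq_pow_sum, map_prod, pow_zero,
    Finset.prod_const_one]

end infinitePart

end ConicReduction

end

/-! ### Construction of the two multipliers -/

noncomputable section

namespace ConicReduction

variable {n : ℕ}

lemma ringPoly_le_ringTwo : ringPoly ≤ ringTwo :=
  Algebra.adjoin_mono (by simp)

lemma ringPolyInv_le_ringOne : ringPolyInv ≤ ringOne :=
  Algebra.adjoin_mono (by simp)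

lemma ringPolyInv_le_ringLaurent : ringPolyInv ≤ ringLaurent :=
  Algebra.adjoin_mono (by simp)

lemma zpow_mem_of_mem {A : Subalgebra ℂ (RatFunc ℂ)} {x : RatFunc ℂ} (h : x ∈ A) (h' : x⁻¹ ∈ A)
    (z : ℤ) : x ^ z ∈ A := by
  obtain ⟨l, rfl | rfl⟩ := z.eq_nat_or_neg
  · rw [zpow_natCast]; exact pow_mem h l
  · rw [_root_.zpow_neg, zpow_natCast, ← inv_pow]; exact pow_mem h' l

lemma w_sub_one_zpow_mem (z : ℤ) : (w - 1) ^ z ∈ ringTwo :=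
  zpow_mem_of_mem (sub_mem (Algebra.subset_adjoin (by simp)) (one_mem _))
    (Algebra.subset_adjoin (by simp)) z

lemma one_sub_two_div_w_zpow_mem (z : ℤ) : (1 - 2 / w) ^ z ∈ ringOne := by
  have h1 : (w⁻¹ : RatFunc ℂ) ∈ ringOne := Algebra.subset_adjoin (by simp)
  have h2 : ((w - 2)⁻¹ : RatFunc ℂ) ∈ ringOne := Algebra.subset_adjoin (by simp)
  have h3 : (2 : RatFunc ℂ) ∈ ringOne := by
    rw [← one_add_one_eq_two]; exact add_mem (one_mem _) (one_mem _)
  refine zpow_mem_of_mem ?_ ?_ z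
  · rw [div_eq_mul_inv]
    exact sub_mem (one_mem _) (mul_mem h3 h1)
  · have : (1 - 2 / w)⁻¹ = 1 + 2 * (w - 2)⁻¹ := by
      rw [one_sub_two_div_w]
      have h0 := w_ne_zero
      have h2 := w_sub_two_ne_zero
      field_simp
      ring
    rw [this]
    exact add_mem (one_mem _) (mul_mem h3 h2)

lemma w_zpow_mem (z : ℤ) : w ^ z ∈ ringLaurent :=
  zpow_mem_of_mem (Algebra.subset_adjoin (by simp)) (Algebra.subset_adjoin (by simp)) z

/-- The first step of the reduction: the multiplier `U₂`, and `U₂ M` up to the scalar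
`w^(-ρ₀) (w-2)^(-ρ₂)`. -/
lemma exists_left_multiplier {M : GL (Fin n) (RatFunc ℂ)} (hn : 1 ≤ n) (hM : M ∈ GLOver n ringS)
    {ρ₀ ρ₁ ρ₂ : ℕ} (h₀ : -minVal (nu 0) M.val = ρ₀) (h₁ : -minVal (nu 1) M.val = ρ₁)
    (h₂ : -minVal (nu 2) M.val = ρ₂) :
    ∃ (L R U₂ : GL (Fin n) (RatFunc ℂ)) (D : Fin n → RatFunc ℂ) (p : Matrix (Fin n) (Fin n) ℂ[X])
      (u : ℂ) (a c : ℕ),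
      IsSmithForm ringPoly (clearFinite M.val) L D R ∧
      U₂.val = Matrix.diagonal (fun i => (w - 1) ^ (-minVal (nu 1) M.val - nu 1 (D i))) *
        (L⁻¹).val ∧
      U₂ ∈ GLOver n ringTwo ∧
      dw U₂.val ≤ (4 * n - 1) * dw M.val ∧
      (U₂ * M).val = (w ^ ρ₀ * (w - 2) ^ ρ₂)⁻¹ • p.map (algebraMap ℂ[X] (RatFunc ℂ)) ∧
      (∀ i j, (p i j).natDegree ≤ 4 * n * dw M.val) ∧
      u ≠ 0 ∧ p.det = C u * triple a 0 c := by
  have b₀ := neg_minVal_nu_le M.val 0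
  have b₁ := neg_minVal_nu_le M.val 1
  have b₂ := neg_minVal_nu_le M.val 2
  rw [h₀, Nat.cast_le] at b₀
  rw [h₁, Nat.cast_le] at b₁
  rw [h₂, Nat.cast_le] at b₂
  obtain ⟨A, hA, hMA, hdeg, a', b', c', hdvd⟩ := exists_clearFinite_eq_map hM h₀ h₁ h₂
  have hdet : A.det ≠ 0 := fun h => triple_ne_zero a' b' c' (zero_dvd_iff.mp (h ▸ hdvd))
  obtain ⟨T, D, R, hT, hR, hD, hTA, hDR⟩ := exists_smith_natDegree_le n A hdet
  have hDdvd : ∀ i, D i ∣ A.det := dvd_det_of_smith hT hTA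
  have hDtriple : ∀ i, ∃ (u : ℂ) (a b c : ℕ), u ≠ 0 ∧ D i = C u * triple a b c := fun i =>
    exists_eq_of_dvd_triple ((hDdvd i).trans hdvd)
  choose u a k c hu hDeq using hDtriple
  have hD0 : ∀ i, D i ≠ 0 := fun i => by
    rw [hDeq]; exact mul_ne_zero (C_ne_zero.mpr (hu i)) (triple_ne_zero _ _ _)
  have hnu : ∀ i, nu 1 (algebraMap ℂ[X] (RatFunc ℂ) (D i)) = k i := fun i => by
    rw [nu_algebraMap _ (hD0 i), hDeq, rootMultiplicity_triple _ (hu i)]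
    norm_num
  have hk : ∀ i, k i ≤ A.det.natDegree := fun i => by
    have h := natDegree_le_of_dvd (hDdvd i) hdet
    rw [hDeq, natDegree_C_mul (hu i), natDegree_triple] at h
    omega
  have hdetdeg := natDegree_det_le A hdeg
  have hTdeg := natDegree_multiplier_le hdet hdeg (T := T) fun i j => by
    rw [hTA, Matrix.diagonal_mul]; exact hDR i j
  set f := algebraMap ℂ[X] (RatFunc ℂ)
  -- This is `T A` with `(w-1)^(k i)` removed from row `i`, so its degree is still at most `deg det
  -- A`.
  let p : Matrix (Fin n) (Fin n) ℂ[X] :=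
    Matrix.diagonal (fun i => C (u i) * triple (a i) 0 (c i)) * R
  have hp : ∀ i j, D i * R i j = p i j * triple 0 (k i) 0 := fun i j => by
    simp only [p, Matrix.diagonal_mul, hDeq, triple]
    ring
  let e : Fin n → RatFunc ℂ := fun i => (w - 1) ^ (-minVal (nu 1) M.val - nu 1 (f (D i)))
  have he : ∀ i, e i = (w - 1) ^ ((ρ₁ : ℤ) - k i) := fun i => by simp only [e, h₁, hnu]
  have he0 : ∀ i, e i ≠ 0 := fun i => zpow_ne_zero _ w_sub_one_ne_zero
  refine ⟨(polyGL f T hT)⁻¹, polyGL f R hR, diagGL e he0 * polyGL f T hT, fun i => f (D i), p, ?_⟩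
  obtain ⟨v, hv, hv'⟩ := isUnit_iff.mp hR
  refine ⟨(∏ i, u i) * v, ∑ i, a i, ∑ i, c i, ?_, ?_, ?_, ?_, ?_, ?_, ?_, ?_⟩
  · rw [hA]
    exact isSmithForm_of_left algebraMap_mem_ringPoly hT hR hD hTA
  · rw [inv_inv]; rfl
  · refine mul_mem (diagGL_mem (fun i => w_sub_one_zpow_mem _) fun i => ?_)
      (GLOver_mono ringPoly_le_ringTwo (polyGL_mem algebraMap_mem_ringPoly T hT))
    rw [← _root_.zpow_neg]
    exact w_sub_one_zpow_mem _
  · refine Finset.sup_le fun ij _ => ?_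
    have hval : (diagGL e he0 * polyGL f T hT).val ij.1 ij.2 =
        (w - 1) ^ ((ρ₁ : ℤ) - k ij.1) * f (T ij.1 ij.2) := by
      change (Matrix.diagonal e * T.map f) ij.1 ij.2 = _
      rw [Matrix.diagonal_mul, he, Matrix.map_apply]
    rw [hval]
    -- The denominator exponent is `k_i - ρ₁`. Subtracting `ρ₁` from `n (d + ρ₀ + ρ₁ + ρ₂)` cancels
    -- one summand, leaving at most `(n-1) 4d + 3d = (4n-1) d`.
    have hki := (hk ij.1).trans hdetdeg
    obtain ⟨m, rfl⟩ : ∃ m, n = m + 1 := ⟨n - 1, by omega⟩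
    rw [Nat.add_sub_cancel] at hTdeg
    have e1 : m * (dw M.val + ρ₀ + ρ₁ + ρ₂) ≤ m * (4 * dw M.val) :=
      Nat.mul_le_mul_left _ (by omega)
    have e2 : (4 * (m + 1) - 1) * dw M.val = m * (4 * dw M.val) + 3 * dw M.val := by
      rw [show 4 * (m + 1) - 1 = 4 * m + 3 by omega]; ring
    rw [add_mul] at hki
    refine ratDeg_zpow_mul_le (hTdeg _ _) ?_ _ ?_ ?_ <;> omega
  · have h1 : T.map f * A.map f = (Matrix.diagonal D * R).map f := by
      rw [← hTA, Matrix.map_mul]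
    rw [← hMA, Matrix.mul_smul] at h1
    have ht := RatFunc.algebraMap_ne_zero (triple_ne_zero ρ₀ ρ₁ ρ₂)
    refine Matrix.ext fun i j => ?_
    have h3 := congrFun (congrFun h1 i) j
    rw [Matrix.smul_apply, smul_eq_mul, Matrix.map_apply, Matrix.diagonal_mul, hp i j, map_mul,
      algebraMap_triple, algebraMap_triple] at h3
    have h4 : (diagGL e he0 * polyGL f T hT * M).val i j = e i * (T.map f * M.val) i j := by
      change (Matrix.diagonal e * T.map f * M.val) i j = _
      rw [Matrix.mul_assoc, Matrix.diagonal_mul]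
    rw [h4, he, Matrix.smul_apply, smul_eq_mul, Matrix.map_apply, zpow_sub₀ w_sub_one_ne_zero,
      zpow_natCast, zpow_natCast]
    have n0 := w_ne_zero
    have n1 := w_sub_one_ne_zero
    have n2 := w_sub_two_ne_zero
    field_simp
    linear_combination h3
  · intro i j
    by_cases hpij : p i j = 0
    · simp [hpij]
    have h5 := hDR i j
    rw [hp i j, natDegree_mul hpij (triple_ne_zero _ _ _)] at h5
    have e1 : n * (dw M.val + ρ₀ + ρ₁ + ρ₂) ≤ n * (4 * dw M.val) :=
      Nat.mul_le_mul_left _ (by omega)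
    have e2 : n * (4 * dw M.val) = 4 * n * dw M.val := by ring
    omega
  · exact mul_ne_zero (Finset.prod_ne_zero_iff.mpr fun i _ => hu i) hv.ne_zero
  · rw [Matrix.det_mul, Matrix.det_diagonal, prod_C_mul_triple, ← hv', C_mul]
    ring

/-- The second step of the reduction: the multiplier `U₁`, from a matrix over `ℂ[w⁻¹]` given as
`w^(-ε) p`. -/
lemma exists_right_multiplier {p : Matrix (Fin n) (Fin n) ℂ[X]} {ε ρ : ℕ}
    (hp : ∀ i j, (p i j).natDegree ≤ ε) {u : ℂ} (hu : u ≠ 0) {a c : ℕ}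
    (hdet : p.det = C u * triple a 0 c) :
    ∃ (U V U₁ : GL (Fin n) (RatFunc ℂ)) (Q : Fin n → RatFunc ℂ),
      IsSmithForm ringPolyInv ((w ^ ε)⁻¹ • p.map (algebraMap ℂ[X] (RatFunc ℂ))) U Q V ∧
      U₁.val = (V⁻¹).val * Matrix.diagonal (fun i => (1 - 2 / w) ^ ((ρ : ℤ) - nu 2 (Q i))) ∧
      U₁ ∈ GLOver n ringOne ∧
      dw U₁.val ≤ (n - 1) * ε + (n * ε + ρ) ∧
      ∀ i, ∃ (v : ℂ) (l : ℕ), v ≠ 0 ∧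
        Q i = algebraMap ℂ (RatFunc ℂ) v * w ^ (-(l : ℤ)) * (1 - 2 / w) ^ (nu 2 (Q i)) := by
  set N : Matrix (Fin n) (Fin n) ℂ[X] := p.map (reflect ε) with hN
  have hNdvd : N.det ∣ X ^ (ε * n) * (1 - 2 * X) ^ c := det_map_reflect_dvd hp hu hdet
  have hN0 : Nᵀ.det ≠ 0 := by
    rw [Matrix.det_transpose]
    intro h
    rw [h, zero_dvd_iff] at hNdvd
    exact mul_ne_zero (pow_ne_zero _ X_ne_zero) (pow_ne_zero _ prime_one_sub_two_mul_X.ne_zero)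
      hNdvd
  have hNdeg : ∀ i j, (Nᵀ i j).natDegree ≤ ε := fun i j => natDegree_reflect_le' (hp j i)
  -- Transposing turns the bounded left multiplier into a bounded right one.
  obtain ⟨T, Q, R, hT, hR, hQ, hTN, hQR⟩ := exists_smith_natDegree_le n Nᵀ hN0
  have hQdvd : ∀ i, Q i ∣ Nᵀ.det := dvd_det_of_smith hT hTN
  have hQpow : ∀ i, ∃ (v : ℂ) (a b : ℕ), v ≠ 0 ∧ Q i = C v * (X ^ a * (1 - 2 * X) ^ b) :=
    fun i => exists_eq_of_dvd_pow_mul_pow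
      (((hQdvd i).trans (by rw [Matrix.det_transpose])).trans hNdvd)
  choose v l b hv hQeq using hQpow
  have hnu : ∀ i, nu 2 (evalInv (Q i)) = b i := fun i => by rw [hQeq, nu_two_evalInv (hv i)]
  have hb : ∀ i, b i ≤ n * ε := fun i => by
    have h := (natDegree_le_of_dvd (hQdvd i) hN0).trans (natDegree_det_le _ hNdeg)
    have h2 : (1 - 2 * X : ℂ[X]).natDegree = 1 := by
      rw [show (1 - 2 * X : ℂ[X]) = C (-2) * X + C 1 by rw [C_neg, map_ofNat, C_1]; ring]
      exact natDegree_linear (by norm_num)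
    rw [hQeq, natDegree_C_mul (hv i), natDegree_mul (pow_ne_zero _ X_ne_zero)
      (pow_ne_zero _ prime_one_sub_two_mul_X.ne_zero), natDegree_pow, natDegree_pow, h2] at h
    omega
  have hTdeg := natDegree_multiplier_le hN0 hNdeg (T := T) fun i j => by
    rw [hTN, Matrix.diagonal_mul]; exact hQR i j
  have hTt : IsUnit Tᵀ.det := by rwa [Matrix.det_transpose]
  have hRt : IsUnit Rᵀ.det := by rwa [Matrix.det_transpose]
  have hNT : N * Tᵀ = Rᵀ * Matrix.diagonal Q := by
    have h := congrArg Matrix.transpose hTN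
    rwa [Matrix.transpose_mul, Matrix.transpose_mul, Matrix.transpose_transpose,
      Matrix.diagonal_transpose] at h
  let e : Fin n → RatFunc ℂ := fun i => (1 - 2 / w) ^ ((ρ : ℤ) - nu 2 (evalInv (Q i)))
  have he0 : ∀ i, e i ≠ 0 := fun i => zpow_ne_zero _ one_sub_two_div_w_ne_zero
  refine ⟨polyGL evalInv Rᵀ hRt, (polyGL evalInv Tᵀ hTt)⁻¹,
    polyGL evalInv Tᵀ hTt * diagGL e he0, fun i => evalInv (Q i), ?_, ?_, ?_, ?_, ?_⟩
  · rw [← map_reflect_eq hp]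
    exact isSmithForm_of_right evalInv_mem_ringPolyInv hTt hRt hQ hNT
  · rw [inv_inv]; rfl
  · refine mul_mem (GLOver_mono ringPolyInv_le_ringOne (polyGL_mem evalInv_mem_ringPolyInv _ hTt))
      (diagGL_mem (fun i => one_sub_two_div_w_zpow_mem _) fun i => ?_)
    rw [← _root_.zpow_neg]
    exact one_sub_two_div_w_zpow_mem _
  · refine Finset.sup_le fun ij _ => ?_
    have hval : (polyGL evalInv Tᵀ hTt * diagGL e he0).val ij.1 ij.2 =
        evalInv (T ij.2 ij.1) * (1 - 2 / w) ^ ((ρ : ℤ) - b ij.2) := by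
      change (Tᵀ.map evalInv * Matrix.diagonal e) ij.1 ij.2 = _
      rw [Matrix.mul_diagonal, Matrix.map_apply, Matrix.transpose_apply]
      simp only [e, hnu]
    rw [hval]
    have := hb ij.2
    exact ratDeg_evalInv_mul_zpow_le (hTdeg _ _) _ (by omega)
  · intro i
    refine ⟨v i, l i, hv i, ?_⟩
    simp only [hnu]
    rw [hQeq, map_mul, map_mul, map_pow, map_pow, evalInv_one_sub_two_mul_X, evalInv_X, evalInv_C,
      zpow_natCast, _root_.zpow_neg, zpow_natCast, inv_pow, mul_assoc]

end ConicReduction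

end

/-! ### Pole orders at infinity and the final estimate -/

noncomputable section

namespace ConicReduction

lemma nuInf_div {p q : ℂ[X]} (hp : p ≠ 0) (hq : q ≠ 0) :
    nuInf ((algebraMap ℂ[X] (RatFunc ℂ) q)⁻¹ * algebraMap ℂ[X] (RatFunc ℂ) p) =
      (q.natDegree : ℤ) - p.natDegree := by
  have hp' := RatFunc.algebraMap_ne_zero hp
  have hq' := RatFunc.algebraMap_ne_zero hq
  rw [nuInf_eq, RatFunc.intDegree_mul (inv_ne_zero hq') hp', RatFunc.intDegree_inv,
    RatFunc.intDegree_polynomial, RatFunc.intDegree_polynomial]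
  ring

/-- Bounds on the pole orders at infinity of `N = w^(-ρ₀) (w-2)^(-ρ₂) p`. -/
lemma natDegree_le_of_minVal_nuInf {n : ℕ} {N : Matrix (Fin n) (Fin n) (RatFunc ℂ)}
    {p : Matrix (Fin n) (Fin n) ℂ[X]} {ρ₀ ρ₂ σ B : ℕ}
    (hN : N = (w ^ ρ₀ * (w - 2) ^ ρ₂)⁻¹ • p.map (algebraMap ℂ[X] (RatFunc ℂ)))
    (hσ : -minVal nuInf N = σ) (hp : ∀ i j, (p i j).natDegree ≤ B) (hB : ρ₀ + ρ₂ ≤ B) :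
    (∀ i j, (p i j).natDegree ≤ σ + ρ₀ + ρ₂) ∧ σ + ρ₀ + ρ₂ ≤ B := by
  have hNij : ∀ i j, N i j = (algebraMap ℂ[X] (RatFunc ℂ) (triple ρ₀ 0 ρ₂))⁻¹ *
      algebraMap ℂ[X] (RatFunc ℂ) (p i j) := fun i j => by
    rw [hN, Matrix.smul_apply, smul_eq_mul, Matrix.map_apply, algebraMap_triple, pow_zero, mul_one]
  have hnu : ∀ i j, p i j ≠ 0 → nuInf (N i j) = ((ρ₀ + ρ₂ : ℕ) : ℤ) - (p i j).natDegree :=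
    fun i j h => by rw [hNij, nuInf_div h (triple_ne_zero _ _ _), natDegree_triple, add_zero]
  constructor
  · intro i j
    by_cases h : p i j = 0
    · simp [h]
    have h1 := minVal_le nuInf N i j
    rw [hnu i j h] at h1
    omega
  -- Either `σ = 0` and `hB` suffices, or the minimum occurs at a nonzero entry, where `σ + ρ₀ + ρ₂`
  -- equals its degree. A zero entry again gives `σ = 0`, by the default value of `nuInf`.
  · rcases minVal_eq nuInf N with h | ⟨i, j, h⟩
    · omega
    · by_cases h0 : p i j = 0
      · rw [hNij, h0, map_zero, mul_zero] at h
        have : nuInf 0 = 0 := by simp [nuInf]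
        omega
      · rw [hnu i j h0] at h
        have := hp i j
        omega

end ConicReduction

end

open ConicReduction

theorem corollary4p5 (n : ℕ) (hn : 1 ≤ n) (M : GL (Fin n) (RatFunc ℂ))
    (hM : M ∈ ConicReduction.GLOver n ConicReduction.ringS) :
    ∃ U₁ U₂ : GL (Fin n) (RatFunc ℂ),
      ConicReduction.IsReduction M U₁ U₂ ∧
      U₁ ∈ ConicReduction.GLOver n ConicReduction.ringOne ∧
      U₂ ∈ ConicReduction.GLOver n ConicReduction.ringTwo ∧
      U₂ * M * U₁ ∈ ConicReduction.GLOver n ConicReduction.ringLaurent ∧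
      (ConicReduction.dw U₁.val : ℤ) ≤ (16 * (n : ℤ) ^ 2 + 1) * ConicReduction.dw M.val ∧
      (ConicReduction.dw U₂.val : ℤ) ≤ (4 * (n : ℤ) - 1) * ConicReduction.dw M.val := by
  obtain ⟨ρ₀, h₀⟩ := Int.eq_ofNat_of_zero_le (neg_nonneg.mpr (minVal_nonpos (nu 0) M.val))
  obtain ⟨ρ₁, h₁⟩ := Int.eq_ofNat_of_zero_le (neg_nonneg.mpr (minVal_nonpos (nu 1) M.val))
  obtain ⟨ρ₂, h₂⟩ := Int.eq_ofNat_of_zero_le (neg_nonneg.mpr (minVal_nonpos (nu 2) M.val))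
  obtain ⟨L, R, U₂, D, p, u, a, c, hLDR, hU₂, hU₂mem, hU₂deg, hN, hpdeg, hu, hdet⟩ :=
    exists_left_multiplier hn hM h₀ h₁ h₂
  obtain ⟨σ, hσ⟩ := Int.eq_ofNat_of_zero_le (neg_nonneg.mpr (minVal_nonpos nuInf (U₂ * M).val))
  have b₀ := neg_minVal_nu_le M.val 0
  have b₂ := neg_minVal_nu_le M.val 2
  rw [h₀, Nat.cast_le] at b₀
  rw [h₂, Nat.cast_le] at b₂
  obtain ⟨hpε, hε⟩ := natDegree_le_of_minVal_nuInf hN hσ hpdeg (by nlinarith)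
  obtain ⟨U, V, U₁, Q, hUQV, hU₁, hU₁mem, hU₁deg, hQ⟩ :=
    exists_right_multiplier (ρ := ρ₂) hpε hu hdet
  have n0 := w_ne_zero
  have n1 := one_sub_two_div_w_ne_zero
  have n2 := w_sub_two_ne_zero
  have hclear : clearInf (minVal (nu 2) M.val) (U₂ * M).val =
      (w ^ (σ + ρ₀ + ρ₂))⁻¹ • p.map (algebraMap ℂ[X] (RatFunc ℂ)) := by
    rw [clearInf, hN, smul_smul, ← hN, h₂, ← neg_neg (minVal nuInf _), hσ, _root_.zpow_neg, zpow_natCast,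
      zpow_natCast, one_sub_two_div_w, div_pow, pow_add, pow_add]
    congr 1
    field_simp
  rw [← hclear] at hUQV
  refine ⟨U₁, U₂, ⟨L, R, D, U, V, Q, hLDR, hU₂, hUQV, by rw [hU₁, h₂]⟩, hU₁mem, hU₂mem, ?_, ?_, ?_⟩
  · choose v l hv hQl using hQ
    have hC : ∀ z : ℂ, z ≠ 0 → algebraMap ℂ (RatFunc ℂ) z ≠ 0 := fun z hz => by simpa using hz
    -- The exponents of `1 - 2/w` from the scalar, `Q i` and `E₂` are `-ρ₂`, `ν₂(Q i)` and `ρ₂ -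
    -- ν₂(Q i)`. They cancel, leaving a monomial in `w`.
    let e : Fin n → RatFunc ℂ := fun i => algebraMap ℂ (RatFunc ℂ) (v i) * w ^ ((σ : ℤ) - l i)
    have he0 : ∀ i, e i ≠ 0 := fun i => mul_ne_zero (hC _ (hv i)) (zpow_ne_zero _ n0)
    have hprod : U₂ * M * U₁ = U * diagGL e he0 := by
      apply Units.ext
      have h1 : (U₂ * M).val = (w ^ (-(σ : ℤ)) * (1 - 2 / w) ^ (ρ₂ : ℤ))⁻¹ •
          (U.val * Matrix.diagonal Q * V.val) := by
        rw [← hUQV.eq, clearInf, h₂, ← neg_neg (minVal nuInf _), hσ, inv_smul_smul₀]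
        exact mul_ne_zero (zpow_ne_zero _ n0) (zpow_ne_zero _ n1)
      have h2 : (U₂ * M * U₁).val = (U₂ * M).val * U₁.val := rfl
      have h3 : V.val * ((V⁻¹).val *
          Matrix.diagonal (fun i => (1 - 2 / w) ^ ((ρ₂ : ℤ) - nu 2 (Q i)))) =
          Matrix.diagonal (fun i => (1 - 2 / w) ^ ((ρ₂ : ℤ) - nu 2 (Q i))) := by
        rw [← Matrix.mul_assoc, Units.mul_inv, Matrix.one_mul]
      rw [h2, h1, hU₁, Matrix.smul_mul, Matrix.mul_assoc, h3, Matrix.mul_assoc,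
        Matrix.diagonal_mul_diagonal, ← Matrix.mul_smul, ← Matrix.diagonal_smul]
      change _ = U.val * Matrix.diagonal e
      congr 2
      funext i
      simp only [Pi.smul_apply, smul_eq_mul, e]
      have hQi := hQl i
      generalize nu 2 (Q i) = m at hQi ⊢
      rw [hQi, zpow_sub₀ n1, zpow_sub₀ n0, _root_.zpow_neg, _root_.zpow_neg]
      have n3 : (1 - 2 / w) ^ m ≠ 0 := zpow_ne_zero _ n1
      have n4 : (1 - 2 / w) ^ (ρ₂ : ℤ) ≠ 0 := zpow_ne_zero _ n1
      generalize (1 - 2 / w) ^ m = x at n3 ⊢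
      generalize (1 - 2 / w) ^ (ρ₂ : ℤ) = y at n4 ⊢
      field_simp
    rw [hprod]
    refine mul_mem (GLOver_mono ringPolyInv_le_ringLaurent hUQV.left_mem)
      (diagGL_mem (fun i => mul_mem (Subalgebra.algebraMap_mem _ _) (w_zpow_mem _)) fun i => ?_)
    rw [mul_inv, ← map_inv₀, ← _root_.zpow_neg]
    exact mul_mem (Subalgebra.algebraMap_mem _ _) (w_zpow_mem _)
  · have e1 : (n - 1) * (σ + ρ₀ + ρ₂) ≤ n * (σ + ρ₀ + ρ₂) :=
      Nat.mul_le_mul_right _ (Nat.sub_le _ _)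
    have e2 : n * (σ + ρ₀ + ρ₂) ≤ n * (4 * n * dw M.val) := Nat.mul_le_mul_left _ hε
    -- The preceding estimates already give the constant `8n² + 1`.
    have e3 : dw U₁.val ≤ (16 * n ^ 2 + 1) * dw M.val := by nlinarith
    exact_mod_cast e3
  · zify at hU₂deg
    rwa [Nat.cast_sub (by omega), Nat.cast_mul, Nat.cast_ofNat, Nat.cast_one] at hU₂deg
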